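/- All hypergraphs are finite, with edges that are distinct sets of vertices; $G$ is $k$-uniform if every edge has exactly $k$ vertices. A path of length $l$ is a sequence $u_1,e_1,u_2,\dots,e_l,u_{l+1}$ of distinct vertices $u_i$ and distinct edges $e_i$ with $u_i,u_{i+1}\in e_i$; a cycle of length $l\ge 2$ is a sequence $u_1,e_1,\dots,u_l,e_l$ of distinct vertices and distinct edges with $u_i,u_{i+1}\in e_i$ (indices modulo $l$). $G$ is connected if any two vertices are joined by a path, and acyclic if it has no cycle; a supertree is a connected acyclic hypergraph. The distance of two vertices is the length of a shortest path between them, and the diameter is the maximum distance. For $k\ge 3$, a $k$-uniform hypertree is a hypergraph isomorphic to the $k$-th power of a tree $T$, which is obtained by adding to every edge of $T$ its own $k-2$ new vertices. Let $\mathbb{S}(m,d,k)$ (resp. $\mathbb{H}(m,d,k)$) be the set of $k$-uniform supertrees (resp. hypertrees) with $m$ edges and diameter $d$. For a $k$-uniform hypergraph $G$ on $n$ vertices let $\mathcal{Q}(G)=\mathcal{D}(G)+\mathcal{A}(G)$ be its signless Laplacian tensor of order $k$ and dimension $n$, where $\mathcal{D}(G)$ is the diagonal tensor of the vertex degrees and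 $\mathcal{A}(G)_{i_1\cdots i_k}=\frac{1}{(k-1)!}$ if $\{i_1,\dots,i_k\}\in E(G)$ and $0$ otherwise. A number $\lambda\in\mathbb{C}$ is an eigenvalue of $\mathcal{Q}(G)$ if there is $x\in\mathbb{C}^n\setminus\{0\}$ with $\sum_{i_2,\dots,i_k}\mathcal{Q}(G)_{i i_2\cdots i_k}x_{i_2}\cdots x_{i_k}=\lambda x_i^{k-1}$ for all $i$, and the signless Laplacian spectral radius is $q(G)=\max\{|\lambda| : \lambda\text{ an eigenvalue of }\mathcal{Q}(G)\}$. **Theorem.** Let $k\ge 3$, $d\ge 3$, $m\ge d+1$ and $G\in\mathbb{S}(m,d,k)\setminus\mathbb{H}(m,d,k)$. Then there is a hypertree $G'\in\mathbb{H}(m,d,k)$ such that $q(G')>q(G)$ (the maxima defining $q(G)$ and $q(G')$ being attained). -/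

import Mathlib

noncomputable section

open Classical in
/-- Entries of the diagonal tensor of order `r + 1` with diagonal `c`. -/
def diagonalTensor {ι : Type*} (r : ℕ) (c : ι → ℂ) : (Fin (r + 1) → ι) → ℂ :=
  fun t => if ∀ j, t j = t 0 then c (t 0) else 0

/-- For a tensor `A` of order `r + 1` and dimension `|ι|`, the vector `A x ^ r`, whose `i`-th
component is `∑_{i₂, …, i_{r+1}} A_{i i₂ … i_{r+1}} x_{i₂} ⋯ x_{i_{r+1}}`. -/
def tensorApply {ι : Type*} [Fintype ι] {r : ℕ} (A : (Fin (r + 1) → ι) → ℂ) (x : ι → ℂ) :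
    ι → ℂ :=
  fun i => ∑ t : Fin r → ι, A (Fin.cons i t) * ∏ j, x (t j)

/-- `z` is an eigenvalue of the tensor `A` of order `r + 1`: there is a nonzero complex vector
`x` with `A x ^ r = z x ^ [r]`, where `x ^ [r]` is the entrywise power. -/
def IsTensorEigenvalue {ι : Type*} [Fintype ι] {r : ℕ} (A : (Fin (r + 1) → ι) → ℂ) (z : ℂ) :
    Prop :=
  ∃ x : ι → ℂ, x ≠ 0 ∧ ∀ i, tensorApply A x i = z * x i ^ r

namespace Hypergraph

/-- Every edge has exactly `k` vertices. -/
def IsUniform {α : Type*} (G : Hypergraph α) (k : ℕ) : Prop :=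
  ∀ e ∈ G.edgeSet, e.Finite ∧ e.ncard = k

/-- `u₀, e₀, u₁, e₁, …, e_{l-1}, u_l` is a path of length `l` in `G`. -/
structure IsPath {α : Type*} (G : Hypergraph α) (l : ℕ) (u : Fin (l + 1) → α)
    (e : Fin l → Set α) : Prop where
  vertex_mem : ∀ i, u i ∈ G.vertexSet
  edge_mem : ∀ i, e i ∈ G.edgeSet
  vertex_injective : Function.Injective u
  edge_injective : Function.Injective e
  left_mem : ∀ i : Fin l, u i.castSucc ∈ e i
  right_mem : ∀ i : Fin l, u i.succ ∈ e i

/-- There is a path of length `l` from `a` to `b`. -/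
def HasPath {α : Type*} (G : Hypergraph α) (a b : α) (l : ℕ) : Prop :=
  ∃ (u : Fin (l + 1) → α) (e : Fin l → Set α), G.IsPath l u e ∧ u 0 = a ∧ u (Fin.last l) = b

/-- Any two vertices are joined by a path. -/
def IsConnected {α : Type*} (G : Hypergraph α) : Prop :=
  ∀ a ∈ G.vertexSet, ∀ b ∈ G.vertexSet, ∃ l, G.HasPath a b l

/-- `u₀, e₀, u₁, e₁, …, u_{l-1}, e_{l-1}, u₀` is a cycle of length `l ≥ 2` in `G`: distinct
vertices, distinct edges, and `uᵢ, uᵢ₊₁ ∈ eᵢ` with indices modulo `l` (`finRotate l` is the cyclic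
shift `i ↦ i + 1`). In particular two edges with two common vertices form a cycle. -/
structure IsCycle {α : Type*} (G : Hypergraph α) (l : ℕ) (u : Fin l → α)
    (e : Fin l → Set α) : Prop where
  two_le : 2 ≤ l
  edge_mem : ∀ i, e i ∈ G.edgeSet
  vertex_injective : Function.Injective u
  edge_injective : Function.Injective e
  left_mem : ∀ i, u i ∈ e i
  right_mem : ∀ i, u (finRotate l i) ∈ e i

/-- `G` contains no cycle. -/
def IsAcyclic {α : Type*} (G : Hypergraph α) : Prop :=
  ∀ (l : ℕ) (u : Fin l → α) (e : Fin l → Set α), ¬ G.IsCycle l u e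

/-- A supertree is a connected acyclic hypergraph. -/
def IsSupertree {α : Type*} (G : Hypergraph α) : Prop :=
  G.IsConnected ∧ G.IsAcyclic

/-- The length of a shortest path from `a` to `b` (used for connected hypergraphs only). -/
def pathDist {α : Type*} (G : Hypergraph α) (a b : α) : ℕ :=
  sInf {l | G.HasPath a b l}

/-- The diameter of a (finite connected) hypergraph: the maximum distance between vertices. -/
def diameter {α : Type*} (G : Hypergraph α) : ℕ :=
  sSup {l | ∃ a ∈ G.vertexSet, ∃ b ∈ G.vertexSet, l = G.pathDist a b}

/-- The `k`-th power of a simple graph `T` (for `k ≥ 3`): to every edge of `T` one adds `k - 2`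
new vertices, different edges receiving different new vertices. -/
def graphPower {W : Type*} (T : SimpleGraph W) (k : ℕ) :
    Hypergraph (W ⊕ (T.edgeSet × Fin (k - 2))) where
  vertexSet := Set.univ
  edgeSet := Set.range fun e : T.edgeSet =>
    (Sum.inl '' {w | w ∈ (e : Sym2 W)}) ∪ Sum.inr '' {p | p.1 = e}
  subset_vertexSet_of_mem_edgeSet' := fun _ _ => Set.subset_univ _

/-- A `k`-uniform hypertree is (an isomorphic copy of) the `k`-th power of a finite tree. -/
def IsHypertree {α : Type*} (G : Hypergraph α) (k : ℕ) : Prop :=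
  ∃ (n : ℕ) (T : SimpleGraph (Fin n)) (f : Fin n ⊕ (T.edgeSet × Fin (k - 2)) → α),
    T.IsTree ∧ Function.Injective f ∧ (graphPower T k).image f = G

/-- `𝕊(m, d, k)`, on vertices from `α`: the `k`-uniform supertrees with `m` edges and diameter
`d`. -/
def supertrees (α : Type*) (m d k : ℕ) : Set (Hypergraph α) :=
  {G | G.IsSupertree ∧ G.IsUniform k ∧ G.edgeSet.ncard = m ∧ G.diameter = d}

/-- `ℍ(m, d, k)`, on vertices from `α`: the `k`-uniform hypertrees with `m` edges and diameter
`d`. -/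
def hypertrees (α : Type*) (m d k : ℕ) : Set (Hypergraph α) :=
  {G | G.IsHypertree k ∧ G.edgeSet.ncard = m ∧ G.diameter = d}

/-- The number of edges containing `v`. -/
def vertexDegree {α : Type*} (G : Hypergraph α) (v : α) : ℕ :=
  {e ∈ G.edgeSet | v ∈ e}.ncard

open Classical in
/-- The adjacency tensor, of order `r + 1`, of an `(r + 1)`-uniform hypergraph: the entry at
`(i₁, …, i_{r+1})` is `1 / r!` if `{i₁, …, i_{r+1}}` is an edge, and `0` otherwise. -/
def adjacencyTensor {α : Type*} (G : Hypergraph α) (r : ℕ) :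
    (Fin (r + 1) → G.vertexSet) → ℂ :=
  fun t => if Set.range (fun j => (t j : α)) ∈ G.edgeSet then 1 / (r.factorial : ℂ) else 0

/-- The signless Laplacian tensor `Q(G) = D(G) + A(G)`, of order `r + 1`, where `D(G)` is the
diagonal tensor of vertex degrees. -/
def signlessLaplacianTensor {α : Type*} (G : Hypergraph α) (r : ℕ) :
    (Fin (r + 1) → G.vertexSet) → ℂ :=
  diagonalTensor r (fun v : G.vertexSet => (G.vertexDegree v : ℂ)) + G.adjacencyTensor r

/-- The set of moduli of the signless Laplacian eigenvalues of a `k`-uniform hypergraph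
(`k ≥ 1`; the tensor has order `(k - 1) + 1 = k`). -/
def signlessLaplacianModuli {α : Type*} [Finite α] (G : Hypergraph α) (k : ℕ) : Set ℝ :=
  letI : Fintype G.vertexSet := Fintype.ofFinite _
  {s | ∃ z : ℂ, IsTensorEigenvalue (G.signlessLaplacianTensor (k - 1)) z ∧ s = ‖z‖}

/-- The signless Laplacian spectral radius `q(G)` of a `k`-uniform hypergraph: the largest modulus
of an eigenvalue of `Q(G)`. -/
def signlessLaplacianSpectralRadius {α : Type*} [Finite α] (G : Hypergraph α) (k : ℕ) : ℝ :=
  sSup (G.signlessLaplacianModuli k)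

end Hypergraph

end

/-! The vertex type is finite, so some supertree with the given parameters maximizes `q`. It
suffices that every supertree that is not a hypertree is strictly beaten by another one with the
same parameters: the maximizer is then a hypertree, and it strictly beats `G`.

If every edge has at most two branch vertices (vertices lying on another edge), the supertree is the
power of a tree (`isHypertree_of_isCore`). Otherwise some edge `e` has three. Deleting `e` puts its
vertices in different components (`IsAcyclic.exists_separatesEdge`), and the ends of a diametral
path lie in at most two of them, so some branch vertex `v` of `e` has neither end in its component.
For another branch vertex `w` of `e`, the edges at `v` other than `e` may be moved to `w`, or those
at `w` to `v`; both moves give a supertree with the same parameters (`moveEdges_mem_supertrees`).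

The radius `q` is the maximum, over nonnegative vectors, of the tensor form divided by the sum of
`k`-th powers, attained at a vector positive on the vertices. Moving edges from the smaller entry to
the larger does not decrease the form. If `q` did not grow, the same vector would be extremal for
both hypergraphs, contradicting the eigenvalue equation at the vertex that lost edges
(`spectralRadius_lt_moveEdges`). -/

namespace Hypergraph

/-! ### Paths, cycles and distances via the section graph -/

/-- The graph in which two vertices are adjacent if they lie in a common set of the family. -/
def sectionGraph {α : Type*} (E : Set (Set α)) : SimpleGraph α where
  Adj a b := a ≠ b ∧ ∃ e ∈ E, a ∈ e ∧ b ∈ e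
  symm := ⟨fun _ _ h => ⟨h.1.symm, h.2.imp fun _ he => ⟨he.1, he.2.2, he.2.1⟩⟩⟩
  loopless := ⟨fun _ h => h.1 rfl⟩

variable {α : Type*}

lemma sectionGraph_reachable {E : Set (Set α)} {e : Set α} (he : e ∈ E) {a b : α} (ha : a ∈ e)
    (hb : b ∈ e) : (sectionGraph E).Reachable a b := by
  by_cases h : a = b
  · rw [h]
  · exact SimpleGraph.Adj.reachable ⟨h, e, he, ha, hb⟩

lemma sectionGraph_dist_le_one {E : Set (Set α)} {e : Set α} (he : e ∈ E) {a b : α} (ha : a ∈ e)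
    (hb : b ∈ e) : (sectionGraph E).dist a b ≤ 1 := by
  by_cases h : a = b
  · simp [h]
  · exact ((sectionGraph E).dist_eq_one_iff_adj.2 ⟨h, e, he, ha, hb⟩).le

/-- On a shortest walk the `i`-th vertex is at distance exactly `i` from the start, so vertices do
not repeat. A repeated edge would be a shortcut. Shortest walks are therefore hypergraph paths. -/
lemma exists_geodesic {E : Set (Set α)} {a b : α} (h : (sectionGraph E).Reachable a b) :
    ∃ (u : Fin ((sectionGraph E).dist a b + 1) → α)
      (e : Fin ((sectionGraph E).dist a b) → Set α),
      u 0 = a ∧ u (Fin.last _) = b ∧ Function.Injective u ∧ Function.Injective e ∧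
      (∀ i, e i ∈ E) ∧ (∀ i, u i.castSucc ∈ e i) ∧ ∀ i, u i.succ ∈ e i := by
  obtain ⟨p, hp⟩ := h.exists_walk_length_eq_dist
  rw [← hp]
  have hadj : ∀ i : Fin p.length, ∃ e ∈ E, p.getVert i ∈ e ∧ p.getVert (i + 1) ∈ e :=
    fun i => (p.adj_getVert_succ i.2).2
  have hdist : ∀ i ≤ p.length, (sectionGraph E).dist a (p.getVert i) = i := by
    intro i hi
    have h1 := (sectionGraph E).dist_le (p.take i)
    have h2 := (sectionGraph E).dist_le (p.drop i)
    have h3 := SimpleGraph.Reachable.dist_triangle_left (p.take i).reachable b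
    have h4 : (p.take i).length = i := by simp [hi]
    have h5 : (p.drop i).length = p.length - i := by simp
    omega
  choose e he hl hr using hadj
  refine ⟨fun i => p.getVert i, e, by simp, by simp, ?_, ?_, he, fun i => by simpa using hl i,
    fun i => by simpa using hr i⟩
  · intro i j hij
    have h1 := hdist i (by omega)
    have h2 := hdist j (by omega)
    simp only at hij
    rw [hij] at h1
    exact Fin.ext (h1.symm.trans h2)
  · have key : ∀ i j : Fin p.length, i < j → e i ≠ e j := by
      intro i j hij heq
      have h1 := hdist i (by omega)
      have h2 := hdist (j + 1) (by omega)
      have h3 := sectionGraph_dist_le_one (he i) (hl i) (heq ▸ hr j)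
      have h4 := SimpleGraph.Reachable.dist_triangle_left (p.take i).reachable (p.getVert (j + 1))
      have : (i : ℕ) < j := hij
      omega
    intro i j hij
    by_contra hne
    rcases lt_or_gt_of_ne hne with h | h
    · exact key i j h hij
    · exact key j i h hij.symm

/-- The function is constant on every edge other than `e` and injective on `e`. -/
def SeparatesEdge (G : Hypergraph α) (e : Set α) (C : α → Set α) : Prop :=
  (∀ g ∈ G.edgeSet, g ≠ e → ∀ x ∈ g, ∀ y ∈ g, C x = C y) ∧ Set.InjOn C e

/-- Each vertex is labelled by its component after deletion of `e`. Two vertices of `e` in one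
component would be joined by a path avoiding `e`, which `e` closes to a cycle. -/
lemma IsAcyclic.exists_separatesEdge {G : Hypergraph α} (hG : G.IsAcyclic) {e : Set α}
    (he : e ∈ G.edgeSet) : ∃ C, G.SeparatesEdge e C := by
  refine ⟨fun x => {y | (sectionGraph (G.edgeSet \ {e})).Reachable x y}, ?_, ?_⟩
  · intro g hg hge x hx y hy
    have hr := sectionGraph_reachable (E := G.edgeSet \ {e}) ⟨hg, hge⟩ hx hy
    ext z
    exact ⟨fun h => hr.symm.trans h, fun h => hr.trans h⟩
  · intro x hx y hy hxy
    by_contra hne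
    have hr : (sectionGraph (G.edgeSet \ {e})).Reachable x y := by
      have : y ∈ {z | (sectionGraph (G.edgeSet \ {e})).Reachable y z} := by simp
      simp only at hxy
      rwa [← hxy] at this
    obtain ⟨u, f, hu0, hul, hui, hfi, hf, hl, hrt⟩ := exists_geodesic hr
    have hpos := hr.pos_dist_of_ne hne
    refine hG _ u (Fin.snoc f e) ⟨by omega, ?_, hui, ?_, ?_, ?_⟩
    · intro i
      refine Fin.lastCases ?_ (fun i => ?_) i
      · simpa using he
      · simpa using (hf i).1
    · rw [Fin.snoc_injective_iff]
      refine ⟨hfi, ?_⟩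
      rintro ⟨i, hi⟩
      exact (hf i).2 hi
    · intro i
      refine Fin.lastCases ?_ (fun i => ?_) i
      · simpa [hul] using hy
      · simpa using hl i
    · intro i
      refine Fin.lastCases ?_ (fun i => ?_) i
      · simpa [hu0, finRotate_last] using hx
      · simpa using hrt i

/-- Around a cycle the edges other than the last keep the label constant, yet the last edge contains
two distinct vertices of the cycle, whose labels must differ. -/
lemma isAcyclic_of_separatesEdge {G : Hypergraph α}
    (h : ∀ e ∈ G.edgeSet, ∃ C, G.SeparatesEdge e C) : G.IsAcyclic := by
  rintro l u e ⟨h2, hE, hu, he, hl, hr⟩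
  obtain ⟨n, rfl⟩ : ∃ n, l = n + 2 := ⟨l - 2, by omega⟩
  obtain ⟨C, hC, hinj⟩ := h (e (Fin.last _)) (hE _)
  have hconst : ∀ i : Fin (n + 2), C (u i) = C (u 0) := by
    intro i
    induction i using Fin.induction with
    | zero => rfl
    | succ i ih =>
      rw [← ih]
      refine hC (e i.castSucc) (hE _) ?_ _ ?_ _ (hl _)
      · intro h
        exact absurd (he h) (Fin.castSucc_lt_last i).ne
      · simpa using hr i.castSucc
  have := hinj (hl (Fin.last _)) (by simpa using hr (Fin.last _)) (hconst _)
  exact absurd (hu this) (Fin.last_pos).ne'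

lemma HasPath.exists_walk {G : Hypergraph α} {a b : α} {l : ℕ} (h : G.HasPath a b l) :
    ∃ p : (sectionGraph G.edgeSet).Walk a b, p.length = l := by
  obtain ⟨u, e, ⟨hV, hE, hu, he, hl, hr⟩, rfl, rfl⟩ := h
  have : ∀ i : Fin (l + 1), ∃ p : (sectionGraph G.edgeSet).Walk (u 0) (u i), p.length = i := by
    intro i
    induction i using Fin.induction with
    | zero => exact ⟨.nil, rfl⟩
    | succ i ih =>
      obtain ⟨p, hp⟩ := ih
      have hadj : (sectionGraph G.edgeSet).Adj (u i.castSucc) (u i.succ) :=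
        ⟨fun h => absurd (hu h) (Fin.castSucc_lt_succ).ne, e i, hE i, hl i, hr i⟩
      exact ⟨p.concat hadj, by simp [hp]⟩
  simpa using this (Fin.last l)

lemma mem_vertexSet_of_reachable {G : Hypergraph α} {a b : α} (ha : a ∈ G.vertexSet)
    (h : (sectionGraph G.edgeSet).Reachable a b) : b ∈ G.vertexSet := by
  obtain ⟨p⟩ := h
  induction p with
  | nil => exact ha
  | cons hadj _ ih =>
    obtain ⟨-, e, he, -, hy⟩ := hadj
    exact ih (G.subset_vertexSet_of_mem_edgeSet' he hy)

lemma hasPath_dist {G : Hypergraph α} {a b : α} (ha : a ∈ G.vertexSet)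
    (h : (sectionGraph G.edgeSet).Reachable a b) :
    G.HasPath a b ((sectionGraph G.edgeSet).dist a b) := by
  have hb := mem_vertexSet_of_reachable ha h
  obtain ⟨u, e, h0, hlast, hu, he, hE, hl, hr⟩ := exists_geodesic h
  refine ⟨u, e, ⟨fun i => ?_, hE, hu, he, hl, hr⟩, h0, hlast⟩
  refine Fin.lastCases ?_ (fun i => ?_) i
  · rwa [hlast]
  · exact G.subset_vertexSet_of_mem_edgeSet' (hE i) (hl i)

lemma isConnected_iff {G : Hypergraph α} : G.IsConnected ↔
    ∀ a ∈ G.vertexSet, ∀ b ∈ G.vertexSet, (sectionGraph G.edgeSet).Reachable a b := by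
  refine ⟨fun h a ha b hb => ?_, fun h a ha b hb => ⟨_, hasPath_dist ha (h a ha b hb)⟩⟩
  obtain ⟨l, hl⟩ := h a ha b hb
  exact ⟨hl.exists_walk.choose⟩

lemma pathDist_eq {G : Hypergraph α} (hG : G.IsConnected) {a b : α} (ha : a ∈ G.vertexSet)
    (hb : b ∈ G.vertexSet) : G.pathDist a b = (sectionGraph G.edgeSet).dist a b := by
  have h := isConnected_iff.1 hG a ha b hb
  refine le_antisymm (Nat.sInf_le (hasPath_dist ha h)) ?_
  obtain ⟨p, hp⟩ := HasPath.exists_walk (Nat.sInf_mem (s := {l | G.HasPath a b l})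
    ⟨_, hasPath_dist ha h⟩)
  exact (SimpleGraph.dist_le p).trans hp.le

section Diameter

variable [Finite α]

lemma pathDist_le_diameter (G : Hypergraph α) {a b : α} (ha : a ∈ G.vertexSet)
    (hb : b ∈ G.vertexSet) : G.pathDist a b ≤ G.diameter := by
  refine le_csSup (Set.Finite.bddAbove ?_) ⟨a, ha, b, hb, rfl⟩
  refine (Set.finite_range fun p : α × α => G.pathDist p.1 p.2).subset ?_
  rintro _ ⟨a, -, b, -, rfl⟩
  exact ⟨(a, b), rfl⟩

lemma exists_pathDist_eq_diameter (G : Hypergraph α) (hV : G.vertexSet.Nonempty) :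
    ∃ a ∈ G.vertexSet, ∃ b ∈ G.vertexSet, G.pathDist a b = G.diameter := by
  obtain ⟨v, hv⟩ := hV
  have := Nat.sSup_mem (s := {l | ∃ a ∈ G.vertexSet, ∃ b ∈ G.vertexSet, l = G.pathDist a b})
    ⟨_, v, hv, v, hv, rfl⟩ ⟨G.diameter, by
      rintro _ ⟨a, ha, b, hb, rfl⟩
      exact G.pathDist_le_diameter ha hb⟩
  obtain ⟨a, ha, b, hb, h⟩ := this
  exact ⟨a, ha, b, hb, h.symm⟩

end Diameter

/-! ### Maps that do not increase distances -/

/-- A map which sends every set of the first family to a point or into a set of the second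
one. -/
def IsLazyMap (E E' : Set (Set α)) (θ : α → α) : Prop :=
  ∀ g ∈ E, (∃ g' ∈ E', ∀ x ∈ g, θ x ∈ g') ∨ ∃ c, ∀ x ∈ g, θ x = c

lemma IsLazyMap.reachable_and_dist_le {E E' : Set (Set α)} {θ : α → α} (hθ : IsLazyMap E E' θ)
    {a b : α} (h : (sectionGraph E).Reachable a b) :
    (sectionGraph E').Reachable (θ a) (θ b) ∧
      (sectionGraph E').dist (θ a) (θ b) ≤ (sectionGraph E).dist a b := by
  obtain ⟨p, hp⟩ := h.exists_walk_length_eq_dist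
  suffices ∃ q : (sectionGraph E').Walk (θ a) (θ b), q.length ≤ p.length by
    obtain ⟨q, hq⟩ := this
    exact ⟨⟨q⟩, hp ▸ (SimpleGraph.dist_le q).trans hq⟩
  clear hp h
  induction p with
  | nil => exact ⟨.nil, le_rfl⟩
  | @cons x y z hadj p ih =>
    obtain ⟨q, hq⟩ := ih
    obtain ⟨g, hg, hx, hy⟩ := hadj.2
    by_cases hxy : θ x = θ y
    · exact ⟨q.copy hxy.symm rfl, by simp; omega⟩
    · rcases hθ g hg with ⟨g', hg', h'⟩ | ⟨c, hc⟩
      · have hadj' : (sectionGraph E').Adj (θ x) (θ y) := ⟨hxy, g', hg', h' x hx, h' y hy⟩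
        exact ⟨.cons hadj' q, by simp; omega⟩
      · exact absurd ((hc x hx).trans (hc y hy).symm) hxy

end Hypergraph

/-! ### Moving edges from one vertex of an edge to another -/

namespace Hypergraph

variable {α : Type*}

open Classical in
/-- The set `f` with `v` replaced by `w`, unless `f = e` or `v ∉ f`. -/
def moveEdge (e : Set α) (v w : α) (f : Set α) : Set α :=
  if f = e ∨ v ∉ f then f else insert w (f \ {v})

/-- The hypergraph obtained by moving all edges at `v` other than `e` from `v` to `w`. -/
def moveEdges (G : Hypergraph α) (e : Set α) (v w : α) (hw : w ∈ G.vertexSet) :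
    Hypergraph α where
  vertexSet := G.vertexSet
  edgeSet := moveEdge e v w '' G.edgeSet
  subset_vertexSet_of_mem_edgeSet' := by
    rintro _ ⟨f, hf, rfl⟩ x hx
    unfold moveEdge at hx
    split_ifs at hx
    · exact G.subset_vertexSet_of_mem_edgeSet' hf hx
    · rcases hx with rfl | hx
      · exact hw
      · exact G.subset_vertexSet_of_mem_edgeSet' hf hx.1

variable {G : Hypergraph α} {e f : Set α} {v w : α} {C : α → Set α}

@[simp]
lemma moveEdge_self : moveEdge e v w e = e := by simp [moveEdge]

lemma moveEdge_of_notMem (h : v ∉ f) : moveEdge e v w f = f := by simp [moveEdge, h]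

lemma moveEdge_of_mem (hf : f ≠ e) (h : v ∈ f) : moveEdge e v w f = insert w (f \ {v}) := by
  simp [moveEdge, h, hf]

lemma SeparatesEdge.eq_of_mem (hC : G.SeparatesEdge e C) (hf : f ∈ G.edgeSet) (hfe : f ≠ e)
    {x y : α} (hx : x ∈ f) (hy : y ∈ f) (hx' : x ∈ e) (hy' : y ∈ e) : x = y :=
  hC.2 hx' hy' (hC.1 f hf hfe x hx y hy)

/-- A moved edge keeps a vertex labelled `C v`; if it equalled an unmoved edge other than `e`, that
edge would also contain `w` and force `C v = C w`. Two moved edges avoid `w` beforehand, so the move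
can be undone. -/
lemma moveEdge_injOn (hC : G.SeparatesEdge e C) (hv : v ∈ e) (hw : w ∈ e) (hvw : v ≠ w)
    (htwo : ∀ f ∈ G.edgeSet, ∀ x, ∃ y ∈ f, y ≠ x) : Set.InjOn (moveEdge e v w) G.edgeSet := by
  have key : ∀ f ∈ G.edgeSet, ∀ g ∈ G.edgeSet, f ≠ e → v ∈ f → (g = e ∨ v ∉ g) →
      moveEdge e v w f ≠ moveEdge e v w g := by
    intro f hf g hg hfe hvf hgv h
    rw [moveEdge_of_mem hfe hvf] at h
    by_cases hge : g = e
    · rw [hge, moveEdge_self] at h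
      have := h ▸ hv
      simp [hvw] at this
    · have hvg := hgv.resolve_left hge
      rw [moveEdge_of_notMem hvg] at h
      obtain ⟨y, hy, hyv⟩ := htwo f hf v
      have h1 := hC.1 f hf hfe v hvf y hy
      have h2 := hC.1 g hg hge y (h ▸ Or.inr ⟨hy, hyv⟩) w (h ▸ Or.inl rfl)
      exact hvw (hC.2 hv hw (h1.trans h2))
  intro f hf g hg h
  by_cases hfv : f = e ∨ v ∉ f
  · by_cases hgv : g = e ∨ v ∉ g
    · simpa [moveEdge, hfv, hgv] using h
    · push Not at hgv
      exact absurd h.symm (key g hg f hf hgv.1 hgv.2 hfv)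
  · push Not at hfv
    by_cases hgv : g = e ∨ v ∉ g
    · exact absurd h (key f hf g hg hfv.1 hfv.2 hgv)
    · push Not at hgv
      have hwf : w ∉ f := fun hwf => hvw (hC.eq_of_mem hf hfv.1 hfv.2 hwf hv hw)
      have hwg : w ∉ g := fun hwg => hvw (hC.eq_of_mem hg hgv.1 hgv.2 hwg hv hw)
      rw [moveEdge_of_mem hfv.1 hfv.2, moveEdge_of_mem hgv.1 hgv.2] at h
      ext x
      have hx := Set.ext_iff.1 h x
      simp only [Set.mem_insert_iff, Set.mem_sdiff, Set.mem_singleton_iff] at hx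
      grind

lemma moveEdges_isUniform {k : ℕ} (hG : G.IsUniform k) (hC : G.SeparatesEdge e C) (hv : v ∈ e)
    (hw : w ∈ e) (hvw : v ≠ w) (hwV : w ∈ G.vertexSet) : (G.moveEdges e v w hwV).IsUniform k := by
  rintro _ ⟨f, hf, rfl⟩
  by_cases hfv : f = e ∨ v ∉ f
  · simpa [moveEdge, hfv] using hG f hf
  · push Not at hfv
    have hwf : w ∉ f := fun hwf => hvw (hC.eq_of_mem hf hfv.1 hfv.2 hwf hv hw)
    obtain ⟨hfin, hcard⟩ := hG f hf
    rw [moveEdge_of_mem hfv.1 hfv.2]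
    refine ⟨(hfin.sdiff).insert w, ?_⟩
    rw [Set.ncard_insert_of_notMem (fun h => hwf h.1) hfin.sdiff,
      Set.ncard_sdiff_singleton_add_one hfv.2 hfin, hcard]

lemma mem_moveEdge {x : α} (hx : x ∈ f) (hxv : x ≠ v) : x ∈ moveEdge e v w f := by
  unfold moveEdge
  split_ifs
  · exact hx
  · exact Or.inr ⟨hx, hxv⟩

lemma mem_moveEdge_of_mem (hf : f ≠ e) (h : v ∈ f) : w ∈ moveEdge e v w f := by
  rw [moveEdge_of_mem hf h]
  exact Or.inl rfl

lemma mem_or_of_mem_moveEdge {x : α} (hx : x ∈ moveEdge e v w f) :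
    (x ∈ f ∧ (f = e ∨ x ≠ v)) ∨ (x = w ∧ v ∈ f ∧ f ≠ e) := by
  unfold moveEdge at hx
  split_ifs at hx with h
  · by_cases hf : f = e
    · exact Or.inl ⟨hx, Or.inl hf⟩
    · exact Or.inl ⟨hx, Or.inr (by rintro rfl; exact (h.resolve_left hf) hx)⟩
  · push Not at h
    rcases hx with rfl | ⟨hx, hxv⟩
    · exact Or.inr ⟨rfl, h.2, h.1⟩
    · exact Or.inl ⟨hx, Or.inr hxv⟩

open Classical in
lemma moveEdges_isAcyclic (hG : G.IsAcyclic) (he : e ∈ G.edgeSet) (hv : v ∈ e) (hw : w ∈ e)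
    (hvw : v ≠ w) (hwV : w ∈ G.vertexSet) : (G.moveEdges e v w hwV).IsAcyclic := by
  apply isAcyclic_of_separatesEdge
  rintro _ ⟨f, hf, rfl⟩
  obtain ⟨C, hC⟩ := hG.exists_separatesEdge hf
  by_cases hfe : f = e
  · subst hfe
    -- What hung at `v` now hangs at `w` and takes its label; `v` alone keeps its own.
    refine ⟨fun x => if x = v then C v else if C x = C v then C w else C x, ?_, ?_⟩
    · rintro _ ⟨g, hg, rfl⟩ hne x hx y hy
      have hgf : g ≠ f := fun h => hne (by rw [h])
      have h1 : ∀ z ∈ moveEdge f v w g, z ≠ v := by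
        rintro z hz rfl
        rcases mem_or_of_mem_moveEdge hz with ⟨-, h⟩ | ⟨h, -⟩
        · exact h.elim hgf (fun h => h rfl)
        · exact hvw h
      by_cases hvg : v ∈ g
      · have h2 : ∀ z ∈ moveEdge f v w g, (if C z = C v then C w else C z) = C w := by
          intro z hz
          rcases mem_or_of_mem_moveEdge hz with ⟨h, -⟩ | ⟨rfl, -⟩
          · rw [if_pos (hC.1 g hg hgf z h v hvg)]
          · simp
        simp only [h1 x hx, h1 y hy, if_false, h2 x hx, h2 y hy]
      · have hx' := h1 x hx
        have hy' := h1 y hy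
        rw [moveEdge_of_notMem hvg] at hx hy
        simp only [hx', hy', if_false, hC.1 g hg hgf x hx y hy]
    · rw [moveEdge_self]
      have key : ∀ x ∈ f, (if x = v then C v else if C x = C v then C w else C x) = C x := by
        intro x hx
        by_cases hxv : x = v
        · simp [hxv]
        · have : C x ≠ C v := fun h => hxv (hC.2 hx hv h)
          simp [hxv, this]
      intro x hx y hy hxy
      simp only [key x hx, key y hy] at hxy
      exact hC.2 hx hy hxy
  -- Since `e` survives in the separation of `f`, the labels of `v` and `w` agree, and the old
  -- labels still work.
  · have hCvw : C v = C w := hC.1 e he (Ne.symm hfe) v hv w hw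
    refine ⟨C, ?_, ?_⟩
    · rintro _ ⟨g, hg, rfl⟩ hne x hx y hy
      have hgf : g ≠ f := fun h => hne (by rw [h])
      have key : ∀ z ∈ moveEdge e v w g, ∃ z' ∈ g, C z = C z' := by
        intro z hz
        rcases mem_or_of_mem_moveEdge hz with ⟨h, -⟩ | ⟨rfl, h, -⟩
        · exact ⟨z, h, rfl⟩
        · exact ⟨v, h, hCvw.symm⟩
      obtain ⟨x', hx', hxx⟩ := key x hx
      obtain ⟨y', hy', hyy⟩ := key y hy
      rw [hxx, hyy, hC.1 g hg hgf x' hx' y' hy']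
    · intro x hx y hy hxy
      rcases mem_or_of_mem_moveEdge hx with ⟨hx1, hx'⟩ | ⟨hxw, hvf, -⟩ <;>
        rcases mem_or_of_mem_moveEdge hy with ⟨hy1, hy'⟩ | ⟨hyw, hvf', -⟩
      · exact hC.2 hx1 hy1 hxy
      · rw [hyw] at hxy
        exact absurd (hC.2 hx1 hvf' (hxy.trans hCvw.symm)) (hx'.resolve_left hfe)
      · rw [hxw] at hxy
        exact absurd (hC.2 hy1 hvf (hxy.symm.trans hCvw.symm)) (hy'.resolve_left hfe)
      · rw [hxw, hyw]

open Classical in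
lemma isLazyMap_moveEdge (he : e ∈ G.edgeSet) (hw : w ∈ e) :
    IsLazyMap G.edgeSet (moveEdge e v w '' G.edgeSet) (fun x => if x = v then w else x) := by
  intro g hg
  refine Or.inl ⟨_, ⟨g, hg, rfl⟩, fun x hx => ?_⟩
  by_cases hge : g = e
  · subst hge
    rw [moveEdge_self]
    dsimp only
    split_ifs
    · exact hw
    · exact hx
  · dsimp only
    split_ifs with h
    · subst h
      exact mem_moveEdge_of_mem hge hx
    · exact mem_moveEdge hx h

lemma moveEdges_isConnected (hG : G.IsConnected) (he : e ∈ G.edgeSet) (hv : v ∈ e) (hw : w ∈ e)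
    (hwV : w ∈ G.vertexSet) : (G.moveEdges e v w hwV).IsConnected := by
  classical
  rw [isConnected_iff] at hG ⊢
  have hvw : (sectionGraph (moveEdge e v w '' G.edgeSet)).Reachable v w :=
    sectionGraph_reachable (E := moveEdge e v w '' G.edgeSet) (e := e) ⟨e, he, moveEdge_self⟩ hv hw
  have key : ∀ x, (sectionGraph (moveEdge e v w '' G.edgeSet)).Reachable x
      (if x = v then w else x) := by
    intro x
    split_ifs with h
    · rwa [h]
    · rfl
  intro a ha b hb
  exact (key a).trans (((isLazyMap_moveEdge he hw).reachable_and_dist_le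
    (hG a ha b hb)).1.trans (key b).symm)

end Hypergraph

/-! ### Invariance of the diameter -/

namespace Hypergraph

variable {α : Type*} {G : Hypergraph α} {e f : Set α} {v w : α} {C : α → Set α}

open Classical in
-- The moved branch is collapsed to `w`, its new point of attachment; `v` and everything with
-- another label stay fixed.
lemma isLazyMap_collapse (hC : G.SeparatesEdge e C) (he : e ∈ G.edgeSet) (hv : v ∈ e)
    (hw : w ∈ e) (hvw : v ≠ w) :
    IsLazyMap (moveEdge e v w '' G.edgeSet) G.edgeSet
      (fun x => if x ≠ v ∧ C x = C v then w else x) := by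
  have hne : C w ≠ C v := fun h => hvw (hC.2 hv hw h.symm)
  rintro _ ⟨g, hg, rfl⟩
  by_cases hge : g = e
  · subst hge
    rw [moveEdge_self]
    refine Or.inl ⟨g, he, fun x hx => ?_⟩
    dsimp only
    split_ifs
    · exact hw
    · exact hx
  · by_cases hz : ∃ z ∈ g, C z = C v
    · obtain ⟨z, hz, hzv⟩ := hz
      refine Or.inr ⟨w, fun x hx => ?_⟩
      rcases mem_or_of_mem_moveEdge hx with ⟨hx, hxv⟩ | ⟨rfl, -⟩
      · exact if_pos ⟨hxv.resolve_left hge, (hC.1 g hg hge x hx z hz).trans hzv⟩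
      · simp
    · push Not at hz
      rw [moveEdge_of_notMem fun h => hz v h rfl]
      refine Or.inl ⟨g, hg, fun x hx => ?_⟩
      simpa [hz x hx] using hx

open Classical in
-- Interchanging `v` and `w` returns the moved branch to its old place, while the original branch at
-- `w` is collapsed to `v`.
lemma isLazyMap_swap_collapse (hC : G.SeparatesEdge e C) (he : e ∈ G.edgeSet) (hv : v ∈ e)
    (hw : w ∈ e) (hvw : v ≠ w) :
    IsLazyMap (moveEdge e v w '' G.edgeSet) G.edgeSet
      (fun x => if x = v then w else if C x = C w then v else x) := by
  have hne : C w ≠ C v := fun h => hvw (hC.2 hv hw h.symm)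
  rintro _ ⟨g, hg, rfl⟩
  by_cases hge : g = e
  · subst hge
    rw [moveEdge_self]
    refine Or.inl ⟨g, he, fun x hx => ?_⟩
    dsimp only
    split_ifs
    · exact hw
    · exact hv
    · exact hx
  · by_cases hvg : v ∈ g
    · refine Or.inl ⟨g, hg, fun x hx => ?_⟩
      rcases mem_or_of_mem_moveEdge hx with ⟨hx, hxv⟩ | ⟨rfl, -⟩
      · have h1 : C x ≠ C w := by rw [hC.1 g hg hge x hx v hvg]; exact hne.symm
        simpa [hxv.resolve_left hge, h1] using hx
      · simpa [hvw.symm] using hvg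
    · rw [moveEdge_of_notMem hvg]
      have hxv : ∀ x ∈ g, x ≠ v := by rintro x hx rfl; exact hvg hx
      by_cases hz : ∃ z ∈ g, C z = C w
      · obtain ⟨z, hz, hzv⟩ := hz
        refine Or.inr ⟨v, fun x hx => ?_⟩
        simp [hxv x hx, (hC.1 g hg hge x hx z hz).trans hzv]
      · push Not at hz
        refine Or.inl ⟨g, hg, fun x hx => ?_⟩
        simpa [hz x hx, hxv x hx] using hx

open Classical in
lemma isLazyMap_collapse_left (hC : G.SeparatesEdge e C) (he : e ∈ G.edgeSet) (hv : v ∈ e) :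
    IsLazyMap G.edgeSet (moveEdge e v w '' G.edgeSet) (fun x => if C x = C v then v else x) := by
  intro g hg
  by_cases hge : g = e
  · subst hge
    refine Or.inl ⟨g, ⟨g, he, moveEdge_self⟩, fun x hx => ?_⟩
    dsimp only
    split_ifs
    · exact hv
    · exact hx
  · by_cases hz : ∃ z ∈ g, C z = C v
    · obtain ⟨z, hz, hzv⟩ := hz
      refine Or.inr ⟨v, fun x hx => ?_⟩
      simp [(hC.1 g hg hge x hx z hz).trans hzv]
    · push Not at hz
      refine Or.inl ⟨g, ⟨g, hg, moveEdge_of_notMem fun h => hz v h rfl⟩, fun x hx => ?_⟩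
      simpa [hz x hx] using hx

open Classical in
-- With `v` sent to `w`, the branch at `v` follows its edges to their new place, and `v` takes over
-- the role of `u`. This bounds new distances from that branch to `v` by old distances to `u`.
lemma isLazyMap_collapse_third (hC : G.SeparatesEdge e C) (he : e ∈ G.edgeSet) (hv : v ∈ e)
    (hw : w ∈ e) {u : α} :
    IsLazyMap G.edgeSet (moveEdge e v w '' G.edgeSet)
      (fun x => if C x = C u then v else if x = v then w else x) := by
  intro g hg
  by_cases hge : g = e
  · subst hge
    refine Or.inl ⟨g, ⟨g, he, moveEdge_self⟩, fun x hx => ?_⟩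
    dsimp only
    split_ifs
    · exact hv
    · exact hw
    · exact hx
  · by_cases hz : ∃ z ∈ g, C z = C u
    · obtain ⟨z, hz, hzv⟩ := hz
      refine Or.inr ⟨v, fun x hx => ?_⟩
      simp [(hC.1 g hg hge x hx z hz).trans hzv]
    · push Not at hz
      refine Or.inl ⟨_, ⟨g, hg, rfl⟩, fun x hx => ?_⟩
      simp only [hz x hx, if_false]
      split_ifs with h
      · subst h
        exact mem_moveEdge_of_mem hge hx
      · exact mem_moveEdge hx h

lemma pathDist_le_of_isLazyMap {G' : Hypergraph α} (hG : G.IsConnected) (hG' : G'.IsConnected)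
    {θ : α → α} (hθ : IsLazyMap G.edgeSet G'.edgeSet θ) {a b : α} (ha : a ∈ G.vertexSet)
    (hb : b ∈ G.vertexSet) (ha' : θ a ∈ G'.vertexSet) (hb' : θ b ∈ G'.vertexSet) :
    G'.pathDist (θ a) (θ b) ≤ G.pathDist a b := by
  rw [pathDist_eq hG ha hb, pathDist_eq hG' ha' hb']
  exact (hθ.reachable_and_dist_le (isConnected_iff.1 hG a ha b hb)).2

lemma pathDist_comm (hG : G.IsConnected) {a b : α} (ha : a ∈ G.vertexSet)
    (hb : b ∈ G.vertexSet) : G.pathDist a b = G.pathDist b a := by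
  rw [pathDist_eq hG ha hb, pathDist_eq hG hb ha, SimpleGraph.dist_comm]

/-- Pairs avoiding `v` are handled by the map sending `v` to `w`. Only distances to `v` can grow:
those from its former branch, which are compared with old distances to another vertex `u` of `e`. -/
lemma diameter_moveEdges_le [Finite α] (hG : G.IsConnected) (hC : G.SeparatesEdge e C)
    (he : e ∈ G.edgeSet) (hv : v ∈ e) (hw : w ∈ e) (hvw : v ≠ w) (hwV : w ∈ G.vertexSet) {u : α}
    (hu : u ∈ e) (huv : u ≠ v) :
    (G.moveEdges e v w hwV).diameter ≤ G.diameter := by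
  classical
  have hG' : (G.moveEdges e v w hwV).IsConnected := moveEdges_isConnected hG he hv hw hwV
  have hvV : v ∈ G.vertexSet := G.subset_vertexSet_of_mem_edgeSet' he hv
  have huV : u ∈ G.vertexSet := G.subset_vertexSet_of_mem_edgeSet' he hu
  have key : ∀ θ : α → α, IsLazyMap G.edgeSet (moveEdge e v w '' G.edgeSet) θ →
      ∀ a ∈ G.vertexSet, ∀ b ∈ G.vertexSet, ∀ a' ∈ G.vertexSet, ∀ b' ∈ G.vertexSet,
      θ a = a' → θ b = b' → (G.moveEdges e v w hwV).pathDist a' b' ≤ G.diameter := by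
    rintro θ hθ a ha b hb _ ha' _ hb' rfl rfl
    exact (pathDist_le_of_isLazyMap hG hG' hθ ha hb ha' hb').trans (pathDist_le_diameter G ha hb)
  have hCvu : C v ≠ C u := fun h => huv (hC.2 hv hu h).symm
  have hleft : ∀ a ∈ G.vertexSet, (G.moveEdges e v w hwV).pathDist a v ≤ G.diameter := by
    intro a ha
    by_cases hav : a = v
    · exact key _ (isLazyMap_collapse_left hC he hv) v hvV v hvV _ ha _ hvV (by simp [hav])
        (by simp)
    by_cases hCa : C a = C v
    · exact key _ (isLazyMap_collapse_third hC he hv hw (u := u)) a ha u huV _ ha _ hvV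
        (by simp [hav, hCa, hCvu]) (by simp)
    · exact key _ (isLazyMap_collapse_left hC he hv) a ha v hvV _ ha _ hvV (by simp [hCa])
        (by simp)
  obtain ⟨a, ha, b, hb, hab⟩ := (G.moveEdges e v w hwV).exists_pathDist_eq_diameter ⟨w, hwV⟩
  rw [← hab]
  by_cases hav : a = v
  · subst hav
    rw [pathDist_comm hG' ha hb]
    exact hleft b hb
  by_cases hbv : b = v
  · subst hbv
    exact hleft a ha
  · exact key _ (isLazyMap_moveEdge he hw) a ha b hb _ ha _ hb (by simp [hav]) (by simp [hbv])

/-- A retraction back to `G` reaches both `a` and `b` provided it does not collapse them: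
`isLazyMap_collapse` if they avoid the branch at `v`, the swapped version if they avoid the one at
`w` (the points `v`, `w` themselves being harmless). -/
lemma le_diameter_moveEdges [Finite α] (hG : G.IsConnected) (hC : G.SeparatesEdge e C)
    (he : e ∈ G.edgeSet) (hv : v ∈ e) (hw : w ∈ e) (hvw : v ≠ w) (hwV : w ∈ G.vertexSet)
    {a b : α} (ha : a ∈ G.vertexSet) (hb : b ∈ G.vertexSet)
    (hab : ((C a = C v → a = v) ∧ (C b = C v → b = v)) ∨
      ((C a = C w → a = w) ∧ (C b = C w → b = w))) :
    G.pathDist a b ≤ (G.moveEdges e v w hwV).diameter := by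
  classical
  have hG' : (G.moveEdges e v w hwV).IsConnected := moveEdges_isConnected hG he hv hw hwV
  have hvV : v ∈ G.vertexSet := G.subset_vertexSet_of_mem_edgeSet' he hv
  have key : ∀ θ : α → α, IsLazyMap (moveEdge e v w '' G.edgeSet) G.edgeSet θ →
      ∀ a' ∈ G.vertexSet, ∀ b' ∈ G.vertexSet, θ a' = a → θ b' = b →
      G.pathDist a b ≤ (G.moveEdges e v w hwV).diameter := by
    intro θ hθ a' ha' b' hb' h1 h2
    have := pathDist_le_of_isLazyMap hG' hG hθ ha' hb' (by rwa [h1]) (by rwa [h2])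
    rw [h1, h2] at this
    exact this.trans (pathDist_le_diameter _ ha' hb')
  rcases hab with ⟨h1, h2⟩ | ⟨h1, h2⟩
  · refine key _ (isLazyMap_collapse hC he hv hw hvw) a ha b hb (if_neg ?_) (if_neg ?_) <;> tauto
  · have hpre : ∀ c ∈ G.vertexSet, (C c = C w → c = w) → ∃ c' ∈ G.vertexSet,
        (if c' = v then w else if C c' = C w then v else c') = c := by
      intro c hc h
      by_cases hcv : c = v
      · exact ⟨w, hwV, by simp [hvw.symm, hcv]⟩
      by_cases hcw : c = w
      · exact ⟨v, hvV, by simp [hcw]⟩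
      · exact ⟨c, hc, by simp [hcv, mt h hcw]⟩
    obtain ⟨a', ha', haa⟩ := hpre a ha h1
    obtain ⟨b', hb', hbb⟩ := hpre b hb h2
    exact key _ (isLazyMap_swap_collapse hC he hv hw hvw) a' ha' b' hb' haa hbb

/-- Moving edges within an edge `e`, away from the vertices at which a diametral path leaves `e`,
gives a supertree with the same parameters. -/
lemma moveEdges_mem_supertrees [Finite α] {m d k : ℕ} (hk : 3 ≤ k)
    (hG : G ∈ supertrees α m d k) (hC : G.SeparatesEdge e C)
    (he : e ∈ G.edgeSet) (hv : v ∈ e) (hw : w ∈ e) (hvw : v ≠ w) (hwV : w ∈ G.vertexSet)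
    {a b : α} (ha : a ∈ G.vertexSet) (hb : b ∈ G.vertexSet) (hd : G.pathDist a b = G.diameter)
    (hab : ((C a = C v → a = v) ∧ (C b = C v → b = v)) ∨
      ((C a = C w → a = w) ∧ (C b = C w → b = w))) :
    G.moveEdges e v w hwV ∈ supertrees α m d k := by
  obtain ⟨⟨hconn, hac⟩, hunif, hm, hdiam⟩ := hG
  have htwo : ∀ f ∈ G.edgeSet, ∀ x, ∃ y ∈ f, y ≠ x := by
    intro f hf x
    exact Set.exists_ne_of_one_lt_ncard (by rw [(hunif f hf).2]; omega) x
  obtain ⟨u, hu, huv⟩ := htwo e he v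
  refine ⟨⟨moveEdges_isConnected hconn he hv hw hwV, moveEdges_isAcyclic hac he hv hw hvw hwV⟩,
    moveEdges_isUniform hunif hC hv hw hvw hwV, ?_, ?_⟩
  · exact ((moveEdge_injOn hC hv hw hvw htwo).ncard_image).trans hm
  · rw [← hdiam]
    exact le_antisymm (diameter_moveEdges_le hconn hC he hv hw hvw hwV hu huv)
      (hd ▸ le_diameter_moveEdges hconn hC he hv hw hvw hwV ha hb hab)

end Hypergraph

/-! ### Supertrees with at most two branch vertices per edge are hypertrees -/

namespace Hypergraph

variable {α : Type*} {G : Hypergraph α} {e f : Set α}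

/-- The vertices of `e` which lie on another edge. -/
def branchVertices (G : Hypergraph α) (e : Set α) : Set α :=
  {x ∈ e | ∃ f ∈ G.edgeSet, f ≠ e ∧ x ∈ f}

lemma IsConnected.exists_mem_edge (hG : G.IsConnected) (he : e ∈ G.edgeSet)
    (h2 : 1 < e.ncard) {x : α} (hx : x ∈ G.vertexSet) : ∃ f ∈ G.edgeSet, x ∈ f := by
  obtain ⟨y, hy, hyx⟩ := Set.exists_ne_of_one_lt_ncard h2 x
  obtain ⟨p⟩ := isConnected_iff.1 hG x hx y (G.subset_vertexSet_of_mem_edgeSet' he hy)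
  cases p with
  | nil => exact absurd rfl hyx
  | cons h _ =>
    obtain ⟨-, f, hf, hxf, -⟩ := h
    exact ⟨f, hf, hxf⟩

lemma eq_pair_of_ncard_eq_two {s : Set α} (hs : s.ncard = 2) {x y : α} (hx : x ∈ s) (hy : y ∈ s)
    (hxy : x ≠ y) : s = {x, y} := by
  have hfin : s.Finite := Set.finite_of_ncard_ne_zero (by omega)
  symm
  apply Set.eq_of_subset_of_ncard_le _ _ hfin
  · rintro z (rfl | rfl) <;> assumption
  · rw [Set.ncard_pair hxy, hs]

/-- The choice of two vertices of every edge among which are all its branch vertices. -/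
structure IsCore (G : Hypergraph α) (c : Set α → Set α) : Prop where
  subset : ∀ e ∈ G.edgeSet, c e ⊆ e
  ncard_eq : ∀ e ∈ G.edgeSet, (c e).ncard = 2
  branch : ∀ e ∈ G.edgeSet, ∀ f ∈ G.edgeSet, f ≠ e → ∀ x ∈ e, x ∈ f → x ∈ c e

lemma exists_isCore {k : ℕ} (hk : 2 ≤ k) (hG : G.IsUniform k)
    (hb : ∀ e ∈ G.edgeSet, (G.branchVertices e).ncard ≤ 2) : ∃ c, G.IsCore c := by
  have : ∀ e : Set α, ∃ c : Set α, e ∈ G.edgeSet → G.branchVertices e ⊆ c ∧ c ⊆ e ∧ c.ncard = 2 := by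
    intro e
    by_cases he : e ∈ G.edgeSet
    · obtain ⟨c, h1, h2, h3⟩ := Set.exists_subsuperset_card_eq
        (show G.branchVertices e ⊆ e from fun x hx => hx.1) (hb e he)
        (by rw [(hG e he).2]; exact hk)
      exact ⟨c, fun _ => ⟨h1, h2, h3⟩⟩
    · exact ⟨∅, fun h => absurd h he⟩
  choose c hc using this
  exact ⟨c, fun e he => (hc e he).2.1, fun e he => (hc e he).2.2,
    fun e he f hf hfe x hx hxf => (hc e he).1 ⟨hx, f, hf, hfe, hxf⟩⟩

variable {c : Set α → Set α}

lemma IsCore.mem_of_mem (hc : G.IsCore c) (he : e ∈ G.edgeSet) (hf : f ∈ G.edgeSet) {x : α}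
    (hx : x ∈ c e) (hxf : x ∈ f) : x ∈ c f := by
  by_cases h : e = f
  · rwa [← h]
  · exact hc.branch f hf e he h x hxf (hc.subset e he hx)

/-- Connectedness follows by retracting all vertices to core vertices. For acyclicity every edge is
a bridge: the labels separating `e` are constant along walks avoiding its core pair but differ at
the two ends of that pair. -/
lemma IsCore.isTree (hc : G.IsCore c) (hG : G.IsSupertree) (hE : G.edgeSet.Nonempty) {ι : Type*}
    {g : ι → α} (hg : Function.Injective g) (hr : Set.range g = ⋃ e ∈ G.edgeSet, c e) :
    ((sectionGraph (c '' G.edgeSet)).comap g).IsTree := by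
  have hmem : ∀ e ∈ G.edgeSet, ∀ x ∈ c e, ∃ i, g i = x := by
    intro e he x hx
    have : x ∈ Set.range g := hr ▸ Set.mem_biUnion he hx
    exact this
  have hgmem : ∀ i, ∃ e ∈ G.edgeSet, g i ∈ c e := by
    intro i
    have : g i ∈ ⋃ e ∈ G.edgeSet, c e := hr ▸ ⟨i, rfl⟩
    simpa using this
  have hne : ∀ e ∈ G.edgeSet, ∃ i, g i ∈ c e := by
    intro e he
    obtain ⟨x, hx⟩ := Set.nonempty_of_ncard_ne_zero (s := c e) (by rw [hc.ncard_eq e he]; simp)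
    obtain ⟨i, rfl⟩ := hmem e he x hx
    exact ⟨i, hx⟩
  obtain ⟨e₀, he₀⟩ := hE
  obtain ⟨i₀, hi₀⟩ := hne e₀ he₀
  rw [SimpleGraph.isTree_iff]
  constructor
  · have hρ : ∀ x, ∃ i, (∀ f ∈ G.edgeSet, x ∈ f → g i ∈ c f) ∧ ∀ j, x = g j → i = j := by
      intro x
      by_cases hx : ∃ i, g i = x
      · obtain ⟨i, rfl⟩ := hx
        obtain ⟨e, he, hie⟩ := hgmem i
        exact ⟨i, fun f hf hif => hc.mem_of_mem he hf hie hif, fun j hj => hg hj⟩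
      · have hxj : ∀ j, x ≠ g j := fun j hj => hx ⟨j, hj.symm⟩
        by_cases hx' : ∃ f ∈ G.edgeSet, x ∈ f
        · obtain ⟨f, hf, hxf⟩ := hx'
          obtain ⟨i, hi⟩ := hne f hf
          refine ⟨i, fun f' hf' hxf' => ?_, fun j hj => absurd hj (hxj j)⟩
          have : f' = f := by
            by_contra h
            exact hx (hmem f hf x (hc.branch f hf f' hf' h x hxf hxf'))
          rwa [this]
        · exact ⟨i₀, fun f hf hxf => absurd ⟨f, hf, hxf⟩ hx', fun j hj => absurd hj (hxj j)⟩
    choose ρ hρ hρg using hρ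
    have hstep : ∀ {a b}, (sectionGraph G.edgeSet).Reachable a b →
        ((sectionGraph (c '' G.edgeSet)).comap g).Reachable (ρ a) (ρ b) := by
      rintro a b ⟨p⟩
      induction p with
      | nil => rfl
      | @cons x y z hadj _ ih =>
        refine SimpleGraph.Reachable.trans ?_ ih
        obtain ⟨-, f, hf, hx, hy⟩ := hadj
        by_cases h : ρ x = ρ y
        · rw [h]
        · exact SimpleGraph.Adj.reachable
            ⟨fun h' => h (hg h'), c f, ⟨f, hf, rfl⟩, hρ x f hf hx, hρ y f hf hy⟩
    have hV : ∀ i, g i ∈ G.vertexSet := by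
      intro i
      obtain ⟨e, he, hi⟩ := hgmem i
      exact G.subset_vertexSet_of_mem_edgeSet' he (hc.subset e he hi)
    have : Nonempty ι := ⟨i₀⟩
    refine ⟨fun i j => ?_⟩
    have := hstep (isConnected_iff.1 hG.1 (g i) (hV i) (g j) (hV j))
    rwa [hρg _ i rfl, hρg _ j rfl] at this
  · rw [SimpleGraph.isAcyclic_iff_forall_adj_isBridge]
    intro i j hij
    rw [SimpleGraph.isBridge_iff]
    obtain ⟨hne, _, ⟨e, he, rfl⟩, hi, hj⟩ := hij
    rintro ⟨p⟩
    obtain ⟨C, hC⟩ := hG.2.exists_separatesEdge he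
    have hpair := eq_pair_of_ncard_eq_two (hc.ncard_eq e he) hi hj hne
    have key : ∀ {a b : ι}, (((sectionGraph (c '' G.edgeSet)).comap g) \
        SimpleGraph.fromEdgeSet {s(i, j)}).Walk a b → C (g a) = C (g b) := by
      intro a b p
      induction p with
      | nil => rfl
      | @cons x y z hadj _ ih =>
        rw [← ih]
        obtain ⟨⟨hxy, _, ⟨f, hf, rfl⟩, hx, hy⟩, hnot⟩ := hadj
        refine hC.1 f hf ?_ _ (hc.subset f hf hx) _ (hc.subset f hf hy)
        rintro rfl
        apply hnot
        rw [SimpleGraph.fromEdgeSet_adj]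
        refine ⟨?_, fun h => hxy (by rw [h])⟩
        rw [hpair] at hx hy
        simp only [Set.mem_insert_iff, Set.mem_singleton_iff, hg.eq_iff] at hx hy
        simp only [Set.mem_singleton_iff, Sym2.eq_iff]
        have : x ≠ y := fun h => hxy (by rw [h])
        grind
    exact hne (hC.2 (hc.subset e he hi) (hc.subset e he hj) (key p))

/-- The core pairs are the edges of the tree; the other `k - 2` vertices of an edge lie on no other
edge, so they serve as its new vertices. -/
lemma isHypertree_of_isCore [Finite α] {k : ℕ} (hk : 2 ≤ k) (hG : G.IsSupertree)
    (hu : G.IsUniform k) (hE : G.edgeSet.Nonempty) (hc : G.IsCore c) : G.IsHypertree k := by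
  obtain ⟨n, ⟨ε⟩⟩ := Finite.exists_equiv_fin (⋃ e ∈ G.edgeSet, c e : Set α)
  set g : Fin n → α := fun i => ε.symm i with hgdef
  have hg : Function.Injective g := Subtype.val_injective.comp ε.symm.injective
  have hr : Set.range g = ⋃ e ∈ G.edgeSet, c e := by
    have : g = Subtype.val ∘ ε.symm := rfl
    rw [this, EquivLike.range_comp, Subtype.range_coe]
  have hmem : ∀ e ∈ G.edgeSet, ∀ x ∈ c e, ∃ i, g i = x := by
    intro e he x hx
    have : x ∈ Set.range g := hr ▸ Set.mem_biUnion he hx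
    exact this
  have hgmem : ∀ i, ∃ e ∈ G.edgeSet, g i ∈ c e := by
    intro i
    have : g i ∈ ⋃ e ∈ G.edgeSet, c e := hr ▸ ⟨i, rfl⟩
    simpa using this
  set T := (sectionGraph (c '' G.edgeSet)).comap g with hT
  have hedge : ∀ t : T.edgeSet, ∃ e ∈ G.edgeSet, g '' {w | w ∈ (t : Sym2 (Fin n))} = c e := by
    rintro ⟨t, ht⟩
    induction t using Sym2.ind with
    | h i j =>
      obtain ⟨hij, _, ⟨e, he, rfl⟩, hi, hj⟩ := ht
      refine ⟨e, he, ?_⟩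
      refine Eq.trans ?_ (eq_pair_of_ncard_eq_two (hc.ncard_eq e he) hi hj hij).symm
      ext x
      simp [eq_comm]
  choose E hEmem hEt using hedge
  have hsurj : ∀ e ∈ G.edgeSet, ∃ t, E t = e := by
    intro e he
    obtain ⟨x, y, hxy, hce⟩ := Set.ncard_eq_two.1 (hc.ncard_eq e he)
    obtain ⟨i, hi⟩ := hmem e he x (by simp [hce])
    obtain ⟨j, hj⟩ := hmem e he y (by simp [hce])
    have hadj : T.Adj i j :=
      ⟨by rwa [hi, hj], c e, ⟨e, he, rfl⟩, by simp [hce, hi], by simp [hce, hj]⟩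
    refine ⟨⟨s(i, j), hadj⟩, ?_⟩
    set t : T.edgeSet := ⟨s(i, j), hadj⟩
    have h1 : x ∈ c (E t) := hEt t ▸ ⟨i, by simp [t], hi⟩
    have h2 : y ∈ c (E t) := hEt t ▸ ⟨j, by simp [t], hj⟩
    -- Distinct edges of an acyclic hypergraph share at most one vertex, so the core pair determines
    -- its edge.
    by_contra hne
    obtain ⟨C, hC⟩ := hG.2.exists_separatesEdge he
    exact hxy (hC.eq_of_mem (hEmem t) hne (hc.subset _ (hEmem t) h1) (hc.subset _ (hEmem t) h2)
      (hc.subset e he (by simp [hce])) (hc.subset e he (by simp [hce])))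
  have hEinj : Function.Injective E := by
    intro t t' h
    have h1 : g '' {w | w ∈ (t : Sym2 (Fin n))} = g '' {w | w ∈ (t' : Sym2 (Fin n))} := by
      rw [hEt, hEt, h]
    have h2 := hg.image_injective h1
    exact Subtype.ext (Sym2.ext fun x => Set.ext_iff.1 h2 x)
  have hrest : ∀ t, ∃ h : Fin (k - 2) → α, Function.Injective h ∧ Set.range h = E t \ c (E t) := by
    intro t
    have hcard : Nat.card (E t \ c (E t) : Set α) = k - 2 := by
      rw [Nat.card_coe_set_eq, Set.ncard_sdiff (hc.subset _ (hEmem t)), hc.ncard_eq _ (hEmem t),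
        (hu _ (hEmem t)).2]
    let ψ := (Finite.equivFinOfCardEq hcard).symm
    refine ⟨Subtype.val ∘ ψ, Subtype.val_injective.comp ψ.injective, ?_⟩
    rw [EquivLike.range_comp, Subtype.range_coe]
  choose h hinj hrange using hrest
  have hhmem : ∀ t i, h t i ∈ E t \ c (E t) := fun t i => hrange t ▸ ⟨i, rfl⟩
  refine ⟨n, T, Sum.elim g (fun p => h p.1 p.2), hc.isTree hG hE hg hr, ?_, ?_⟩
  · rw [Sum.elim_injective]
    refine ⟨hg, ?_, ?_⟩
    · rintro ⟨t, i⟩ ⟨t', i'⟩ hh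
      have htt : t = t' := by
        by_contra hne
        have h1 := hhmem t i
        have h2 := hhmem t' i'
        simp only at hh
        exact h1.2 (hc.branch _ (hEmem t) _ (hEmem t') (fun h' => hne (hEinj h').symm) _ h1.1
          (hh ▸ h2.1))
      subst htt
      exact congrArg (Prod.mk t) (hinj t hh)
    · rintro i ⟨t, j⟩ hij
      obtain ⟨e, he, hie⟩ := hgmem i
      have h1 := hhmem t j
      simp only at hij
      rw [hij] at hie
      exact h1.2 (hc.mem_of_mem he (hEmem t) hie h1.1)
  · have himg : ∀ t : T.edgeSet, Sum.elim g (fun p : T.edgeSet × Fin (k - 2) => h p.1 p.2) ''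
        ((Sum.inl '' {w | w ∈ (t : Sym2 (Fin n))}) ∪ Sum.inr '' {p | p.1 = t}) = E t := by
      intro t
      have h2 : (fun p : T.edgeSet × Fin (k - 2) => h p.1 p.2) '' {p | p.1 = t} =
          E t \ c (E t) := by
        rw [← hrange t]
        ext x
        constructor
        · rintro ⟨⟨_, i⟩, rfl, rfl⟩
          exact ⟨i, rfl⟩
        · rintro ⟨i, rfl⟩
          exact ⟨(t, i), rfl, rfl⟩
      rw [Set.image_union, Set.image_image, Set.image_image]
      simp only [Sum.elim_inl, Sum.elim_inr]
      rw [hEt, h2, Set.union_sdiff_cancel (hc.subset _ (hEmem t))]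
    have hEset : ((graphPower T k).image
        (Sum.elim g (fun p : T.edgeSet × Fin (k - 2) => h p.1 p.2))).edgeSet = G.edgeSet := by
      ext e
      constructor
      · rintro ⟨_, ⟨t, rfl⟩, rfl⟩
        rw [himg t]
        exact hEmem t
      · intro he
        obtain ⟨t, rfl⟩ := hsurj e he
        exact ⟨_, ⟨t, rfl⟩, himg t⟩
    refine Hypergraph.ext ?_ hEset
    ext x
    constructor
    · rintro ⟨i | ⟨t, i⟩, -, rfl⟩
      · obtain ⟨e, he, hi⟩ := hgmem i
        exact G.subset_vertexSet_of_mem_edgeSet' he (hc.subset e he hi)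
      · exact G.subset_vertexSet_of_mem_edgeSet' (hEmem t) (hhmem t i).1
    · intro hx
      obtain ⟨e, he⟩ := hE
      obtain ⟨f, hf, hxf⟩ := hG.1.exists_mem_edge he (by rw [(hu e he).2]; omega) hx
      rw [← hEset] at hf
      exact Hypergraph.subset_vertexSet_of_mem_edgeSet' _ hf hxf

lemma nonempty_vertexSet_of_mem_supertrees {m d k : ℕ} (hk : 1 ≤ k) (hm : 1 ≤ m)
    (hG : G ∈ supertrees α m d k) : G.vertexSet.Nonempty := by
  obtain ⟨-, hunif, hcard, -⟩ := hG
  obtain ⟨e, he⟩ := Set.nonempty_of_ncard_ne_zero (s := G.edgeSet) (by omega)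
  obtain ⟨v, hv⟩ := Set.nonempty_of_ncard_ne_zero (s := e) (by rw [(hunif e he).2]; omega)
  exact ⟨v, G.subset_vertexSet_of_mem_edgeSet' he hv⟩

end Hypergraph

/-! ### Variational characterization: existence and positivity of the Perron vector -/

namespace Hypergraph

open Filter Topology

variable {α : Type*} {G : Hypergraph α} {k r : ℕ} {q : ℝ} {x : α → ℝ}

/-- The contribution of an edge to the form of the signless Laplacian tensor. -/
def edgeForm (k : ℕ) (s : Finset α) (x : α → ℝ) : ℝ := ∑ v ∈ s, x v ^ k + k * ∏ v ∈ s, x v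

lemma edgeForm_nonneg {s : Finset α} (hx : ∀ v, 0 ≤ x v) : 0 ≤ edgeForm k s x :=
  add_nonneg (Finset.sum_nonneg fun v _ => pow_nonneg (hx v) _)
    (mul_nonneg k.cast_nonneg (Finset.prod_nonneg fun v _ => hx v))

lemma edgeForm_mono {s : Finset α} {y : α → ℝ} (hx : ∀ v, 0 ≤ x v) (hxy : ∀ v, x v ≤ y v) :
    edgeForm k s x ≤ edgeForm k s y := by
  unfold edgeForm
  gcongr with v _ v _
  · exact hx v
  · exact hxy v
  · exact fun v _ => hx v
  · exact hxy v

open Classical in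
lemma edgeForm_update {s : Finset α} {v : α} {t : ℝ} :
    edgeForm k s (Function.update x v t) = edgeForm k s x +
      if v ∈ s then (t ^ k - x v ^ k) + k * ((t - x v) * ∏ u ∈ s.erase v, x u) else 0 := by
  unfold edgeForm
  split_ifs with hv
  · have h1 : ∀ u ∈ s.erase v, Function.update x v t u = x u := fun u hu =>
      Function.update_of_ne (Finset.ne_of_mem_erase hu) _ _
    rw [← Finset.add_sum_erase s _ hv, ← Finset.mul_prod_erase s _ hv,
      ← Finset.add_sum_erase s (fun u => x u ^ k) hv, ← Finset.mul_prod_erase s x hv,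
      Finset.prod_congr rfl h1, Finset.sum_congr rfl fun u hu => by rw [h1 u hu]]
    simp only [Function.update_self]
    ring
  · have h1 : ∀ u ∈ s, Function.update x v t u = x u := fun u hu =>
      Function.update_of_ne (by rintro rfl; exact hv hu) _ _
    rw [Finset.prod_congr rfl h1, Finset.sum_congr rfl fun u hu => by rw [h1 u hu]]
    ring

variable [Fintype α]

open Classical in
/-- The vertices, as a finite set. -/
noncomputable def vertexFinset (G : Hypergraph α) : Finset α := {v | v ∈ G.vertexSet}

open Classical in
/-- The edges, as a finite set of finite sets. -/
noncomputable def edgeFinset (G : Hypergraph α) : Finset (Finset α) :=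
  {s | (s : Set α) ∈ G.edgeSet}

@[simp]
lemma mem_vertexFinset {v : α} : v ∈ G.vertexFinset ↔ v ∈ G.vertexSet := by
  simp [vertexFinset]

@[simp]
lemma mem_edgeFinset {s : Finset α} : s ∈ G.edgeFinset ↔ (s : Set α) ∈ G.edgeSet := by
  simp [edgeFinset]

lemma mem_vertexFinset_of_mem {s : Finset α} (hs : s ∈ G.edgeFinset) {v : α} (hv : v ∈ s) :
    v ∈ G.vertexFinset :=
  mem_vertexFinset.2 (G.subset_vertexSet_of_mem_edgeSet' (mem_edgeFinset.1 hs) hv)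

lemma IsUniform.card_eq (hG : G.IsUniform k) {s : Finset α} (hs : s ∈ G.edgeFinset) :
    s.card = k := by
  rw [← Set.ncard_coe_finset]
  exact (hG _ (mem_edgeFinset.1 hs)).2

/-- The form `x ↦ ∑ᵢ xᵢ (Q x ^ (k - 1))ᵢ` of the signless Laplacian tensor `Q`. -/
noncomputable def laplacianForm (G : Hypergraph α) (k : ℕ) (x : α → ℝ) : ℝ :=
  ∑ s ∈ G.edgeFinset, edgeForm k s x

/-- The sum of the `k`-th powers of the entries. -/
noncomputable def powerSum (G : Hypergraph α) (k : ℕ) (x : α → ℝ) : ℝ :=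
  ∑ v ∈ G.vertexFinset, x v ^ k

/-- `x` maximizes the quotient of `laplacianForm` and `powerSum` among the nonnegative vectors,
and `q` is the maximum. -/
structure IsPerronPair (G : Hypergraph α) (k : ℕ) (q : ℝ) (x : α → ℝ) : Prop where
  nonneg : ∀ v, 0 ≤ x v
  powerSum_pos : 0 < G.powerSum k x
  eq : G.laplacianForm k x = q * G.powerSum k x
  le : ∀ y : α → ℝ, (∀ v, 0 ≤ y v) → G.laplacianForm k y ≤ q * G.powerSum k y

lemma laplacianForm_nonneg (hx : ∀ v, 0 ≤ x v) : 0 ≤ G.laplacianForm k x :=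
  Finset.sum_nonneg fun _ _ => edgeForm_nonneg hx

lemma powerSum_nonneg (hx : ∀ v, 0 ≤ x v) : 0 ≤ G.powerSum k x :=
  Finset.sum_nonneg fun v _ => pow_nonneg (hx v) _

lemma IsPerronPair.eigenvalue_nonneg (h : G.IsPerronPair k q x) : 0 ≤ q := by
  have h1 := laplacianForm_nonneg (G := G) (k := k) h.nonneg
  rw [h.eq] at h1
  exact nonneg_of_mul_nonneg_left h1 h.powerSum_pos

lemma laplacianForm_smul (hG : G.IsUniform k) {y : α → ℝ} {a : ℝ}
    (hy : ∀ v ∈ G.vertexFinset, y v = a * x v) :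
    G.laplacianForm k y = a ^ k * G.laplacianForm k x := by
  unfold laplacianForm
  rw [Finset.mul_sum]
  refine Finset.sum_congr rfl fun s hs => ?_
  have h : ∀ v ∈ s, y v = a * x v := fun v hv => hy v (mem_vertexFinset_of_mem hs hv)
  unfold edgeForm
  rw [Finset.prod_congr rfl h, Finset.prod_mul_distrib, Finset.prod_const, hG.card_eq hs,
    Finset.sum_congr rfl fun v hv => by rw [h v hv, mul_pow], ← Finset.mul_sum]
  ring

lemma powerSum_smul {y : α → ℝ} {a : ℝ} (hy : ∀ v ∈ G.vertexFinset, y v = a * x v) :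
    G.powerSum k y = a ^ k * G.powerSum k x := by
  unfold powerSum
  rw [Finset.mul_sum]
  exact Finset.sum_congr rfl fun v hv => by rw [hy v hv, mul_pow]

theorem exists_isPerronPair (hG : G.IsUniform k) (hk : k ≠ 0) (hV : G.vertexSet.Nonempty) :
    ∃ q x, G.IsPerronPair k q x := by
  classical
  -- The cube also bounds the coordinates outside the vertex set, which `powerSum` does not see; it
  -- makes `K` compact.
  set K : Set (α → ℝ) := Set.univ.pi (fun _ => Set.Icc 0 1) ∩ {x | G.powerSum k x = 1}
  have hcN : Continuous (G.powerSum k) := by unfold powerSum; fun_prop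
  have hcF : Continuous (G.laplacianForm k) := by unfold laplacianForm edgeForm; fun_prop
  have hK : IsCompact K :=
    (isCompact_univ_pi fun _ => isCompact_Icc).inter_right (isClosed_eq hcN continuous_const)
  have hne : K.Nonempty := by
    obtain ⟨v₀, hv₀⟩ := hV
    refine ⟨fun v => if v = v₀ then 1 else 0, fun v _ => ?_, ?_⟩
    · dsimp only
      split_ifs <;> simp
    · simp [powerSum, ite_pow, hk, hv₀]
  obtain ⟨x, ⟨hx01, hxN⟩, hmax⟩ := hK.exists_isMaxOn hne hcF.continuousOn
  have hxN : G.powerSum k x = 1 := hxN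
  refine ⟨G.laplacianForm k x, x, fun v => (hx01 v trivial).1, by rw [hxN]; exact one_pos,
    by rw [hxN, mul_one], fun y hy => ?_⟩
  rcases (powerSum_nonneg (G := G) (k := k) hy).eq_or_lt with h0 | hpos
  · have hz : ∀ v ∈ G.vertexFinset, y v = 0 * x v := by
      intro v hv
      have := (Finset.sum_eq_zero_iff_of_nonneg fun v _ => pow_nonneg (hy v) k).1 h0.symm v hv
      rw [zero_mul, pow_eq_zero_iff hk |>.1 this]
    rw [laplacianForm_smul hG hz, ← h0]
    simp [hk]
  · set c := G.powerSum k y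
    set ρ := c ^ ((k : ℝ)⁻¹)
    have hρ : 0 < ρ := Real.rpow_pos_of_pos hpos _
    have hρk : ρ ^ k = c := Real.rpow_inv_natCast_pow hpos.le hk
    set y' : α → ℝ := fun v => if v ∈ G.vertexFinset then ρ⁻¹ * y v else 0
    have hy' : ∀ v ∈ G.vertexFinset, y' v = ρ⁻¹ * y v := fun v hv => if_pos hv
    have hy'0 : ∀ v, 0 ≤ y' v := by
      intro v
      simp only [y']
      split_ifs
      · exact mul_nonneg (inv_nonneg.2 hρ.le) (hy v)
      · exact le_rfl
    have hN' : G.powerSum k y' = 1 := by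
      rw [powerSum_smul hy', inv_pow, hρk]
      exact inv_mul_cancel₀ hpos.ne'
    have hmem : y' ∈ K := by
      refine ⟨fun v _ => ⟨hy'0 v, ?_⟩, hN'⟩
      by_cases hv : v ∈ G.vertexFinset
      · have h1 := Finset.single_le_sum (f := fun v => y' v ^ k)
          (fun v _ => pow_nonneg (hy'0 v) k) hv
        exact (pow_le_one_iff_of_nonneg (hy'0 v) hk).1 (h1.trans hN'.le)
      · simp only [y', if_neg hv, zero_le_one]
    have h1 : G.laplacianForm k y' ≤ G.laplacianForm k x := hmax hmem
    rw [laplacianForm_smul hG hy', inv_pow, hρk, inv_mul_le_iff₀ hpos] at h1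
    rwa [mul_comm]

/-- First-order condition for a maximum on the half-line. At an interior point the derivative
vanishes; at `c = 0` the linear term dominates for small `t`, giving `b ≤ 0` and hence `b = 0`. -/
lemma eq_zero_of_forall_le {a b c : ℝ} (hr : r ≠ 0) (hb : 0 ≤ b) (hc : 0 ≤ c)
    (h : ∀ t, 0 ≤ t → a * t ^ (r + 1) + (r + 1) * b * t ≤ a * c ^ (r + 1) + (r + 1) * b * c) :
    a * c ^ r + b = 0 := by
  have hr1 : (0 : ℝ) < r + 1 := by positivity
  rcases hc.eq_or_lt with rfl | hc
  · have h1 : ∀ᶠ t in 𝓝[>] (0 : ℝ), a * t ^ r + (r + 1) * b ≤ 0 := by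
      filter_upwards [self_mem_nhdsWithin] with t ht
      have ht : 0 < t := ht
      have := h t ht.le
      simp only [ne_eq, Nat.add_eq_zero_iff, one_ne_zero, and_false, not_false_eq_true, zero_pow,
        mul_zero, add_zero] at this
      rw [pow_succ] at this
      by_contra! h'
      nlinarith [mul_pos h' ht]
    have h2 : Tendsto (fun t : ℝ => a * t ^ r + (r + 1) * b) (𝓝[>] 0)
        (𝓝 (a * 0 ^ r + (r + 1) * b)) :=
      (Continuous.tendsto (by fun_prop) 0).mono_left nhdsWithin_le_nhds
    have h3 := le_of_tendsto h2 h1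
    rw [zero_pow hr, mul_zero, zero_add] at h3 ⊢
    nlinarith
  · have hd : HasDerivAt (fun t : ℝ => a * t ^ (r + 1) + (r + 1) * b * t)
        (a * (((r + 1 : ℕ) : ℝ) * c ^ r * 1) + (r + 1) * b * 1) c :=
      ((((hasDerivAt_id c).pow (r + 1))).const_mul a).add ((hasDerivAt_id c).const_mul _)
    have hmax : IsLocalMax (fun t : ℝ => a * t ^ (r + 1) + (r + 1) * b * t) c := by
      filter_upwards [lt_mem_nhds hc] with t ht using h t ht.le
    have := hmax.hasDerivAt_eq_zero hd
    push_cast at this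
    have h4 : (r + 1) * (a * c ^ r + b) = 0 := by linarith
    exact (mul_eq_zero.1 h4).resolve_left hr1.ne'

open Classical in
-- When only the entry at `v` varies, form minus `q` times power sum is, up to a constant, `(D - q)
-- * t ^ (r + 1) + (r + 1) * S * t`, maximal at `t = x v`.
theorem IsPerronPair.eigen_eq (h : G.IsPerronPair (r + 1) q x) (hr : r ≠ 0) {v : α}
    (hv : v ∈ G.vertexSet) :
    ∑ s ∈ G.edgeFinset with v ∈ s, (x v ^ r + ∏ u ∈ s.erase v, x u) = q * x v ^ r := by
  set D := ((G.edgeFinset.filter (v ∈ ·)).card : ℝ)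
  set S := ∑ s ∈ G.edgeFinset with v ∈ s, ∏ u ∈ s.erase v, x u
  have hS : 0 ≤ S := Finset.sum_nonneg fun s _ => Finset.prod_nonneg fun u _ => h.nonneg u
  have hF : ∀ t, G.laplacianForm (r + 1) (Function.update x v t) = G.laplacianForm (r + 1) x +
      (D * (t ^ (r + 1) - x v ^ (r + 1)) + (r + 1) * ((t - x v) * S)) := by
    intro t
    unfold laplacianForm
    simp only [edgeForm_update]
    rw [Finset.sum_add_distrib, ← Finset.sum_filter, Finset.sum_add_distrib, Finset.sum_const,
      ← Finset.mul_sum, ← Finset.mul_sum, nsmul_eq_mul]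
    push_cast
    rfl
  have hN : ∀ t, G.powerSum (r + 1) (Function.update x v t) = G.powerSum (r + 1) x +
      (t ^ (r + 1) - x v ^ (r + 1)) := by
    intro t
    unfold powerSum
    have hv' : v ∈ G.vertexFinset := mem_vertexFinset.2 hv
    rw [← Finset.add_sum_erase _ _ hv', ← Finset.add_sum_erase _ (fun u => x u ^ (r + 1)) hv',
      Finset.sum_congr rfl fun u hu => by
        rw [Function.update_of_ne (Finset.ne_of_mem_erase hu)]]
    simp only [Function.update_self]
    ring
  have key := eq_zero_of_forall_le (a := D - q) (b := S) (c := x v) hr hS (h.nonneg v) (by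
    intro t ht
    have h1 := h.le (Function.update x v t) (by
      intro u
      by_cases hu : u = v
      · rw [hu, Function.update_self]
        exact ht
      · rw [Function.update_of_ne hu]
        exact h.nonneg u)
    rw [hF, hN, h.eq] at h1
    linarith)
  rw [Finset.sum_add_distrib, Finset.sum_const, nsmul_eq_mul]
  linarith

/-- Otherwise connectedness gives an edge with both zero and nonzero entries. Raising its zeros to a
small `t` gains at least order `t ^ r` in the form and costs only order `t ^ (r + 1)` in the power
sum. -/
theorem IsPerronPair.pos (h : G.IsPerronPair (r + 1) q x) (hG : G.IsUniform (r + 1))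
    (hc : G.IsConnected) {v : α} (hv : v ∈ G.vertexSet) : 0 < x v := by
  classical
  by_contra hv0
  have hv0 : x v = 0 := le_antisymm (not_lt.1 hv0) (h.nonneg v)
  obtain ⟨s, hs, a, ha, b, hb, ha0, hb0⟩ : ∃ s ∈ G.edgeFinset, ∃ a ∈ s, ∃ b ∈ s,
      x a = 0 ∧ x b ≠ 0 := by
    by_contra! hno
    have hprop : ∀ {a b}, (sectionGraph G.edgeSet).Reachable a b → x a = 0 → x b = 0 := by
      rintro a b ⟨p⟩
      induction p with
      | nil => exact id
      | @cons a b c hadj _ ih =>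
        intro ha
        obtain ⟨-, e, he, hae, hbe⟩ := hadj
        exact ih (hno e.toFinset (by simpa using he) a (by simpa using hae) b
          (by simpa using hbe) ha)
    refine h.powerSum_pos.ne' (Finset.sum_eq_zero fun u hu => ?_)
    rw [hprop (isConnected_iff.1 hc v hv u (mem_vertexFinset.1 hu)) hv0]
    simp
  set c := ∏ u ∈ s with ¬ x u = 0, x u
  have hcpos : 0 < c := Finset.prod_pos fun u hu =>
    lt_of_le_of_ne (h.nonneg u) (Ne.symm (Finset.mem_filter.1 hu).2)
  have hq := h.eigenvalue_nonneg
  -- Chosen so that both `t ≤ 1` and `q * t < c` hold.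
  set t := c / (q + c + 1)
  have hden : 0 < q + c + 1 := by positivity
  have ht0 : 0 < t := div_pos hcpos hden
  have ht1 : t ≤ 1 := (div_le_one hden).2 (by linarith)
  have htq : q * t < c := by
    have : q * t = c * (q / (q + c + 1)) := by simp only [t]; ring
    rw [this]
    exact mul_lt_of_lt_one_right hcpos ((div_lt_one hden).2 (by linarith))
  set y : α → ℝ := fun u => if u ∈ s ∧ x u = 0 then t else x u
  have hxy : ∀ u, x u ≤ y u := by
    intro u
    simp only [y]
    split_ifs with hu
    · rw [hu.2]
      exact ht0.le
    · exact le_rfl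
  have hy0 : ∀ u, 0 ≤ y u := fun u => (h.nonneg u).trans (hxy u)
  have hN : G.powerSum (r + 1) y ≤ G.powerSum (r + 1) x + (r + 1) * t ^ (r + 1) := by
    calc G.powerSum (r + 1) y
        ≤ ∑ u ∈ G.vertexFinset, (x u ^ (r + 1) + if u ∈ s then t ^ (r + 1) else 0) := by
          refine Finset.sum_le_sum fun u _ => ?_
          simp only [y]
          by_cases hu : u ∈ s
          · by_cases hu0 : x u = 0
            · simp [hu, hu0]
            · simp [hu, hu0, ht0.le]
          · simp [hu]
      _ = G.powerSum (r + 1) x + (G.vertexFinset.filter (· ∈ s)).card * t ^ (r + 1) := by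
          rw [Finset.sum_add_distrib, ← Finset.sum_filter, Finset.sum_const, nsmul_eq_mul]
          rfl
      _ ≤ _ := by
          gcongr
          have : (G.vertexFinset.filter (· ∈ s)).card ≤ s.card :=
            Finset.card_le_card fun u hu => (Finset.mem_filter.1 hu).2
          rw [hG.card_eq hs] at this
          exact_mod_cast this
  have hs1 : edgeForm (r + 1) s x + (r + 1) * (t ^ r * c) ≤ edgeForm (r + 1) s y := by
    have hx0 : ∏ u ∈ s, x u = 0 := Finset.prod_eq_zero ha ha0
    have hyprod : ∏ u ∈ s, y u = t ^ (s.filter (x · = 0)).card * c := by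
      rw [← Finset.prod_const, ← Finset.prod_ite]
      refine Finset.prod_congr rfl fun u hu => ?_
      simp [y, hu]
    have hj : (s.filter (x · = 0)).card ≤ r := by
      have : (s.filter (x · = 0)).card < s.card :=
        Finset.card_lt_card (Finset.filter_ssubset.2 ⟨b, hb, hb0⟩)
      rw [hG.card_eq hs] at this
      omega
    unfold edgeForm
    rw [hx0, hyprod]
    push_cast
    have h1 : t ^ r * c ≤ t ^ (s.filter (x · = 0)).card * c :=
      mul_le_mul_of_nonneg_right (pow_le_pow_of_le_one ht0.le ht1 hj) hcpos.le
    have h2 : ∑ u ∈ s, x u ^ (r + 1) ≤ ∑ u ∈ s, y u ^ (r + 1) :=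
      Finset.sum_le_sum fun u _ => pow_le_pow_left₀ (h.nonneg u) (hxy u) _
    have h3 := mul_le_mul_of_nonneg_left h1 (show (0 : ℝ) ≤ r + 1 by positivity)
    linarith
  have hF : G.laplacianForm (r + 1) x + (r + 1) * (t ^ r * c) ≤ G.laplacianForm (r + 1) y := by
    unfold laplacianForm
    rw [← Finset.add_sum_erase _ _ hs, ← Finset.add_sum_erase _ (fun s => edgeForm _ s y) hs]
    have := Finset.sum_le_sum fun s' (_ : s' ∈ G.edgeFinset.erase s) =>
      edgeForm_mono (k := r + 1) (s := s') h.nonneg hxy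
    linarith
  have h1 := h.le y hy0
  have h2 := mul_le_mul_of_nonneg_left hN hq
  have h3 := h.eq
  have h4 : (r + 1) * (t ^ r * c) ≤ q * ((r + 1) * t ^ (r + 1)) := by linarith
  have h5 : ((r + 1) * t ^ r) * c ≤ ((r + 1) * t ^ r) * (q * t) := by
    calc _ = (r + 1) * (t ^ r * c) := by ring
      _ ≤ q * ((r + 1) * t ^ (r + 1)) := h4
      _ = _ := by ring
  exact absurd (le_of_mul_le_mul_left h5 (by positivity)) (not_le.2 htq)

end Hypergraph

/-! ### The Perron value is the spectral radius of the tensor -/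

namespace Hypergraph

variable {α : Type*} [Fintype α] {G : Hypergraph α} {k r : ℕ} {q : ℝ} {x : α → ℝ}

lemma tensorApply_add {ι : Type*} [Fintype ι] (A B : (Fin (r + 1) → ι) → ℂ) (x : ι → ℂ) (i : ι) :
    tensorApply (A + B) x i = tensorApply A x i + tensorApply B x i := by
  simp [tensorApply, add_mul, Finset.sum_add_distrib]

lemma tensorApply_diagonalTensor {ι : Type*} [Fintype ι] (c : ι → ℂ) (x : ι → ℂ) (i : ι) :
    tensorApply (diagonalTensor r c) x i = c i * x i ^ r := by
  classical
  unfold tensorApply diagonalTensor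
  rw [Finset.sum_eq_single (fun _ => i)]
  · rw [if_pos (fun j => by refine Fin.cases ?_ (fun _ => ?_) j <;> simp)]
    simp
  · intro t _ ht
    rw [if_neg, zero_mul]
    intro h
    exact ht (funext fun j => by simpa using h j.succ)
  · simp

open Classical in
lemma vertexDegree_eq (G : Hypergraph α) (v : α) :
    G.vertexDegree v = (G.edgeFinset.filter (v ∈ ·)).card := by
  unfold vertexDegree
  rw [← Set.ncard_coe_finset, ← Set.ncard_image_of_injective _ Finset.coe_injective]
  congr 1
  ext e
  constructor
  · rintro ⟨he, hv⟩
    exact ⟨e.toFinset, by simp [he, hv], by simp⟩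
  · rintro ⟨s, hs, rfl⟩
    simpa using hs

open Classical in
-- The contributing tuples are the bijections from `Fin r` to `s.erase i`; their number `r!` cancels
-- the factor in the adjacency tensor.
lemma sum_ite_range_eq [Fintype G.vertexSet] {s : Finset α} (hs : s ∈ G.edgeFinset)
    (hcard : s.card = r + 1) (X : α → ℂ) (i : G.vertexSet) (hi : (i : α) ∈ s) :
    ∑ t : Fin r → G.vertexSet,
      (if Set.range (fun j => ((Fin.cons i t : Fin (r + 1) → G.vertexSet) j : α)) = s
        then ∏ j, X (t j) else 0) = r.factorial * ∏ u ∈ s.erase i, X u := by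
  have hrange : ∀ t : Fin r → G.vertexSet,
      Set.range (fun j => ((Fin.cons i t : Fin (r + 1) → G.vertexSet) j : α)) =
        insert (i : α) (Set.range fun j => (t j : α)) := by
    intro t
    ext y
    simp [Fin.exists_fin_succ, eq_comm]
  have hfacts : ∀ t : Fin r → G.vertexSet,
      insert (i : α) (Set.range fun j => (t j : α)) = s →
      Function.Injective (fun j => (t j : α)) ∧
        Finset.univ.image (fun j => (t j : α)) = s.erase i := by
    intro t ht
    have h1 : s.erase i ⊆ Finset.univ.image (fun j => (t j : α)) := by
      intro y hy
      have hy' : y ∈ (s : Set α) := Finset.mem_of_mem_erase hy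
      rw [← ht] at hy'
      rcases hy' with h | ⟨j, hj⟩
      · exact absurd h (Finset.ne_of_mem_erase hy)
      · exact Finset.mem_image.2 ⟨j, Finset.mem_univ j, hj⟩
    have hce : (s.erase (i : α)).card = r := by rw [Finset.card_erase_of_mem hi, hcard]; rfl
    have h2 : (Finset.univ.image (fun j => (t j : α))).card ≤ r :=
      Finset.card_image_le.trans (by simp)
    have h3 := Finset.eq_of_subset_of_card_le h1 (by rw [hce]; exact h2)
    refine ⟨?_, h3.symm⟩
    have h4 : (Finset.univ.image (fun j => (t j : α))).card = (Finset.univ : Finset (Fin r)).card := by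
      rw [← h3, hce]
      simp
    exact fun a b hab => Finset.card_image_iff.1 h4 (Finset.mem_coe.2 (Finset.mem_univ a))
      (Finset.mem_coe.2 (Finset.mem_univ b)) hab
  have hprod : ∀ t : Fin r → G.vertexSet,
      insert (i : α) (Set.range fun j => (t j : α)) = s →
      ∏ j, X (t j) = ∏ u ∈ s.erase i, X u := by
    intro t ht
    obtain ⟨h1, h2⟩ := hfacts t ht
    rw [← h2, Finset.prod_image fun a _ b _ hab => h1 hab]
  simp only [hrange]
  rw [← Finset.sum_filter,
    Finset.sum_congr rfl fun t ht => hprod t (Finset.mem_filter.1 ht).2, Finset.sum_const,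
    nsmul_eq_mul]
  congr 2
  have hcardE : Fintype.card (Fin r ↪ s.erase (i : α)) = r.factorial := by
    rw [Fintype.card_embedding_eq, Fintype.card_coe, Finset.card_erase_of_mem hi, hcard]
    simp [Nat.descFactorial_self]
  rw [← hcardE, ← Finset.card_univ]
  symm
  refine Finset.card_bij (fun φ _ => fun j => (⟨(φ j : α),
    mem_vertexFinset.1 (mem_vertexFinset_of_mem hs (Finset.mem_of_mem_erase (φ j).2))⟩ :
      G.vertexSet)) ?_ ?_ ?_
  · intro φ _
    have hsurj : Function.Surjective φ := by
      refine ((Fintype.bijective_iff_injective_and_card φ).2 ⟨φ.injective, ?_⟩).2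
      rw [Fintype.card_coe, Finset.card_erase_of_mem hi, hcard]
      simp
    simp only [Finset.mem_filter, Finset.mem_univ, true_and]
    ext y
    constructor
    · rintro (rfl | ⟨j, rfl⟩)
      · exact hi
      · exact Finset.mem_of_mem_erase (φ j).2
    · intro hy
      by_cases hyi : y = i
      · exact Or.inl hyi
      · obtain ⟨j, hj⟩ := hsurj ⟨y, Finset.mem_erase.2 ⟨hyi, hy⟩⟩
        exact Or.inr ⟨j, by simp [hj]⟩
  · intro φ _ ψ _ h
    ext j
    exact Subtype.mk.inj (congrFun h j)
  · intro t ht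
    obtain ⟨h1, h2⟩ := hfacts t (Finset.mem_filter.1 ht).2
    refine ⟨⟨fun j => ⟨(t j : α), h2 ▸ Finset.mem_image_of_mem _ (Finset.mem_univ j)⟩,
      fun a b hab => h1 (Subtype.mk.inj hab)⟩, Finset.mem_univ _, rfl⟩

open Classical in
theorem tensorApply_signlessLaplacianTensor [Fintype G.vertexSet] (hG : G.IsUniform (r + 1))
    (X : α → ℂ) (i : G.vertexSet) :
    tensorApply (G.signlessLaplacianTensor r) (fun v => X v) i =
      ∑ s ∈ G.edgeFinset with (i : α) ∈ s, (X i ^ r + ∏ u ∈ s.erase (i : α), X u) := by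
  unfold signlessLaplacianTensor
  rw [tensorApply_add, tensorApply_diagonalTensor, vertexDegree_eq, Finset.sum_add_distrib,
    Finset.sum_const, nsmul_eq_mul]
  congr 1
  have h1 : ∀ t : Fin r → G.vertexSet, G.adjacencyTensor r (Fin.cons i t) * ∏ j, X (t j) =
      ∑ s ∈ G.edgeFinset with (i : α) ∈ s, 1 / (r.factorial : ℂ) *
        (if Set.range (fun j => ((Fin.cons i t : Fin (r + 1) → G.vertexSet) j : α)) = s
          then ∏ j, X (t j) else 0) := by
    intro t
    unfold adjacencyTensor
    set R := Set.range (fun j => ((Fin.cons i t : Fin (r + 1) → G.vertexSet) j : α)) with hR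
    have hiR : (i : α) ∈ R := ⟨0, by simp⟩
    by_cases hmem : R ∈ G.edgeSet
    · rw [if_pos hmem, Finset.sum_eq_single R.toFinset]
      · simp
      · intro s _ hs
        rw [if_neg, mul_zero]
        intro h
        exact hs (by simp [h])
      · intro h
        exact absurd (by simp [hmem, hiR]) h
    · rw [if_neg hmem, zero_mul]
      symm
      refine Finset.sum_eq_zero fun s hs => ?_
      rw [if_neg, mul_zero]
      intro h
      exact hmem (h ▸ mem_edgeFinset.1 (Finset.mem_filter.1 hs).1)
  unfold tensorApply
  rw [Finset.sum_congr rfl fun t _ => h1 t, Finset.sum_comm]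
  refine Finset.sum_congr rfl fun s hs => ?_
  obtain ⟨hsE, his⟩ := Finset.mem_filter.1 hs
  rw [← Finset.mul_sum, sum_ite_range_eq hsE (hG.card_eq hsE) X i his, one_div,
    inv_mul_cancel_left₀ (by exact_mod_cast r.factorial_ne_zero)]

open Classical in
lemma sum_vertex_sum_edge (hG : G.IsUniform (r + 1)) (x : α → ℝ) :
    ∑ v ∈ G.vertexFinset, x v * ∑ s ∈ G.edgeFinset with v ∈ s, (x v ^ r + ∏ u ∈ s.erase v, x u) =
      G.laplacianForm (r + 1) x := by
  have h1 : ∀ v ∈ G.vertexFinset,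
      x v * ∑ s ∈ G.edgeFinset with v ∈ s, (x v ^ r + ∏ u ∈ s.erase v, x u) =
        ∑ s ∈ G.edgeFinset, if v ∈ s then x v ^ (r + 1) + ∏ u ∈ s, x u else 0 := by
    intro v _
    rw [Finset.mul_sum, Finset.sum_filter]
    refine Finset.sum_congr rfl fun s _ => ?_
    split_ifs with hv
    · rw [← Finset.mul_prod_erase s x hv]
      ring
    · rfl
  rw [Finset.sum_congr rfl h1, Finset.sum_comm]
  refine Finset.sum_congr rfl fun s hs => ?_
  rw [← Finset.sum_filter]
  have h2 : G.vertexFinset.filter (· ∈ s) = s := by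
    ext v
    simp only [Finset.mem_filter, and_iff_right_iff_imp]
    exact fun hv => mem_vertexFinset_of_mem hs hv
  rw [h2, Finset.sum_add_distrib, Finset.sum_const, hG.card_eq hs, nsmul_eq_mul]
  rfl

theorem IsPerronPair.isTensorEigenvalue [Fintype G.vertexSet] (h : G.IsPerronPair (r + 1) q x)
    (hr : r ≠ 0) (hG : G.IsUniform (r + 1)) :
    IsTensorEigenvalue (G.signlessLaplacianTensor r) (q : ℂ) := by
  classical
  refine ⟨fun v => (x v : ℂ), ?_, fun i => ?_⟩
  · intro h0
    refine h.powerSum_pos.ne' (Finset.sum_eq_zero fun v hv => ?_)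
    have : (x v : ℂ) = 0 := congrFun h0 ⟨v, mem_vertexFinset.1 hv⟩
    rw [Complex.ofReal_eq_zero.1 this]
    simp
  · rw [tensorApply_signlessLaplacianTensor hG (fun v => (x v : ℂ)) i]
    have := h.eigen_eq hr i.2
    beta_reduce
    exact_mod_cast this

/-- The moduli of an eigenvector satisfy the eigenvalue equation as an inequality; multiplying by
the entries and summing bounds `‖z‖` by the maximal quotient. -/
theorem IsPerronPair.norm_le [Fintype G.vertexSet] (h : G.IsPerronPair (r + 1) q x)
    (hG : G.IsUniform (r + 1)) {z : ℂ}
    (hz : IsTensorEigenvalue (G.signlessLaplacianTensor r) z) : ‖z‖ ≤ q := by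
  classical
  obtain ⟨y, hy0, hy⟩ := hz
  set X : α → ℂ := fun v => if hv : v ∈ G.vertexSet then y ⟨v, hv⟩ else 0
  have hX : y = fun v : G.vertexSet => X v := by
    ext v
    simp [X]
  set Y : α → ℝ := fun v => ‖X v‖
  have hY : ∀ v, 0 ≤ Y v := fun v => norm_nonneg _
  have hpos : 0 < G.powerSum (r + 1) Y := by
    obtain ⟨v, hv⟩ := Function.ne_iff.1 hy0
    refine Finset.sum_pos' (fun v _ => pow_nonneg (hY v) _)
      ⟨v, mem_vertexFinset.2 v.2, pow_pos (norm_pos_iff.2 ?_) _⟩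
    have : X v = y v := by rw [hX]
    rw [this]
    exact hv
  have hle : ∀ v ∈ G.vertexFinset,
      ‖z‖ * Y v ^ r ≤ ∑ s ∈ G.edgeFinset with v ∈ s, (Y v ^ r + ∏ u ∈ s.erase v, Y u) := by
    intro v hv
    have h1 := hy ⟨v, mem_vertexFinset.1 hv⟩
    rw [hX, tensorApply_signlessLaplacianTensor hG X] at h1
    have h2 : ‖z‖ * Y v ^ r = ‖z * X v ^ r‖ := by simp [Y]
    rw [h2, ← h1]
    refine (norm_sum_le _ _).trans (Finset.sum_le_sum fun s _ => (norm_add_le _ _).trans ?_)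
    simp [Y]
  have hsum : ‖z‖ * G.powerSum (r + 1) Y ≤ G.laplacianForm (r + 1) Y := by
    rw [← sum_vertex_sum_edge hG, powerSum, Finset.mul_sum]
    refine Finset.sum_le_sum fun v hv => ?_
    calc ‖z‖ * Y v ^ (r + 1) = Y v * (‖z‖ * Y v ^ r) := by ring
      _ ≤ _ := mul_le_mul_of_nonneg_left (hle v hv) (hY v)
  exact le_of_mul_le_mul_right (hsum.trans (h.le Y hY)) hpos

theorem IsPerronPair.isGreatest (h : G.IsPerronPair (r + 1) q x) (hr : r ≠ 0)
    (hG : G.IsUniform (r + 1)) : IsGreatest (G.signlessLaplacianModuli (r + 1)) q := by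
  let : Fintype G.vertexSet := Fintype.ofFinite _
  constructor
  · refine ⟨(q : ℂ), h.isTensorEigenvalue hr hG, ?_⟩
    rw [Complex.norm_real, Real.norm_of_nonneg h.eigenvalue_nonneg]
  · rintro _ ⟨z, hz, rfl⟩
    exact h.norm_le hG hz

theorem IsPerronPair.spectralRadius_eq (h : G.IsPerronPair (r + 1) q x) (hr : r ≠ 0)
    (hG : G.IsUniform (r + 1)) : G.signlessLaplacianSpectralRadius (r + 1) = q :=
  (h.isGreatest hr hG).csSup_eq

theorem isGreatest_spectralRadius (hr : r ≠ 0) (hG : G.IsUniform (r + 1))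
    (hV : G.vertexSet.Nonempty) : IsGreatest (G.signlessLaplacianModuli (r + 1))
      (G.signlessLaplacianSpectralRadius (r + 1)) := by
  obtain ⟨q, x, h⟩ := exists_isPerronPair hG (by simp) hV
  rw [h.spectralRadius_eq hr hG]
  exact h.isGreatest hr hG

/-! ### Moving edges towards the larger Perron entry -/

section Move

variable {e : Set α} {v w : α} {C : α → Set α}

lemma laplacianForm_le_moveEdges (hk : 2 ≤ k) (hG : G.IsUniform k) (hC : G.SeparatesEdge e C)
    (hv : v ∈ e) (hw : w ∈ e) (hvw : v ≠ w) (hwV : w ∈ G.vertexSet) (hx : ∀ u, 0 ≤ x u)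
    (hxvw : x v ≤ x w) : G.laplacianForm k x ≤ (G.moveEdges e v w hwV).laplacianForm k x := by
  classical
  set M : Finset α → Finset α := fun s => (moveEdge e v w s).toFinset
  have hM : ∀ s, (M s : Set α) = moveEdge e v w s := fun s => by simp [M]
  have htwo : ∀ f ∈ G.edgeSet, ∀ x, ∃ y ∈ f, y ≠ x := by
    intro f hf x
    exact Set.exists_ne_of_one_lt_ncard (by rw [(hG f hf).2]; omega) x
  have hinj : Set.InjOn M G.edgeFinset := by
    intro s hs t ht hst
    have := moveEdge_injOn hC hv hw hvw htwo (mem_edgeFinset.1 hs) (mem_edgeFinset.1 ht)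
      (by rw [← hM, ← hM, hst])
    exact_mod_cast this
  have himg : (G.moveEdges e v w hwV).edgeFinset = G.edgeFinset.image M := by
    ext s
    rw [mem_edgeFinset, Finset.mem_image]
    constructor
    · rintro ⟨f, hf, hfs⟩
      refine ⟨f.toFinset, by simpa using hf, ?_⟩
      apply Finset.coe_injective
      rw [hM, ← hfs]
      simp
    · rintro ⟨t, ht, rfl⟩
      exact ⟨t, mem_edgeFinset.1 ht, (hM t).symm⟩
  unfold laplacianForm
  rw [himg, Finset.sum_image hinj]
  refine Finset.sum_le_sum fun s hs => ?_
  by_cases hs' : (s : Set α) = e ∨ v ∉ (s : Set α)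
  · have : M s = s := by
      apply Finset.coe_injective
      rw [hM]
      exact if_pos hs'
    rw [this]
  · push Not at hs'
    obtain ⟨hse, hvs⟩ := hs'
    have hws : w ∉ s := fun h => hvw (hC.eq_of_mem (mem_edgeFinset.1 hs) hse hvs h hv hw)
    have hMs : M s = insert w (s.erase v) := by
      apply Finset.coe_injective
      rw [hM, moveEdge_of_mem hse hvs]
      simp
    have hvs : v ∈ s := hvs
    have hw' : w ∉ s.erase v := fun h => hws (Finset.mem_of_mem_erase h)
    rw [hMs]
    unfold edgeForm
    rw [Finset.sum_insert hw', Finset.prod_insert hw',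
      ← Finset.add_sum_erase s (fun u => x u ^ k) hvs, ← Finset.mul_prod_erase s x hvs]
    gcongr
    · exact hx v
    · exact Finset.prod_nonneg fun u _ => hx u

/-- Without growth, `x` is a Perron vector of both hypergraphs with the same value. The eigenvalue
equations at `v` then have equal right sides, but the left side has lost the positive term of an
edge `f ≠ e`. -/
theorem spectralRadius_lt_moveEdges (hr : r ≠ 0) (hG : G.IsUniform (r + 1))
    (hconn : G.IsConnected) (hC : G.SeparatesEdge e C) (he : e ∈ G.edgeSet)
    (hv : v ∈ e) (hw : w ∈ e) (hvw : v ≠ w) (hwV : w ∈ G.vertexSet)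
    (hvb : v ∈ G.branchVertices e) (h : G.IsPerronPair (r + 1) q x) (hxvw : x v ≤ x w) :
    G.signlessLaplacianSpectralRadius (r + 1) <
      (G.moveEdges e v w hwV).signlessLaplacianSpectralRadius (r + 1) := by
  classical
  have hG' : (G.moveEdges e v w hwV).IsUniform (r + 1) := moveEdges_isUniform hG hC hv hw hvw hwV
  obtain ⟨q', x', h'⟩ := exists_isPerronPair hG' (by simp) ⟨w, hwV⟩
  rw [h.spectralRadius_eq hr hG, h'.spectralRadius_eq hr hG']
  by_contra! hle
  have hN : (G.moveEdges e v w hwV).powerSum (r + 1) x = G.powerSum (r + 1) x := rfl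
  have h1 := laplacianForm_le_moveEdges (k := r + 1) (by omega) hG hC hv hw hvw hwV h.nonneg hxvw
  have h2 := h'.le x h.nonneg
  rw [hN] at h2
  have h3 : q' = q := by
    refine le_antisymm hle (le_of_mul_le_mul_right ?_ h.powerSum_pos)
    rw [← h.eq]
    exact h1.trans h2
  subst h3
  have h'' : (G.moveEdges e v w hwV).IsPerronPair (r + 1) q' x :=
    ⟨h.nonneg, h.powerSum_pos, le_antisymm h2 (h.eq ▸ h1), h'.le⟩
  have hvV : v ∈ G.vertexSet := G.subset_vertexSet_of_mem_edgeSet' he hv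
  have e1 := h.eigen_eq hr hvV
  have e2 := h''.eigen_eq hr (v := v) hvV
  rw [← e1] at e2
  obtain ⟨-, f, hf, hfe, hvf⟩ := hvb
  refine e2.not_lt (Finset.sum_lt_sum_of_subset (i := f.toFinset) ?_ (by simp [hf, hvf]) ?_ ?_ ?_)
  · intro s hs
    obtain ⟨⟨g, hg, hgs⟩, hvs⟩ := by simpa only [Finset.mem_filter, mem_edgeFinset] using hs
    have hvs' : v ∈ moveEdge e v w g := hgs ▸ hvs
    rcases mem_or_of_mem_moveEdge hvs' with ⟨-, hge⟩ | ⟨h, -⟩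
    · have hge := hge.resolve_right (fun h => h rfl)
      subst hge
      rw [moveEdge_self] at hgs
      simp only [Finset.mem_filter, mem_edgeFinset]
      exact ⟨hgs ▸ he, hvs⟩
    · exact absurd h hvw
  · intro hs
    obtain ⟨⟨g, hg, hgs⟩, hvs⟩ := by simpa only [Finset.mem_filter, mem_edgeFinset] using hs
    rw [Set.coe_toFinset] at hgs
    have hvs' : v ∈ moveEdge e v w g := hgs ▸ hvf
    rcases mem_or_of_mem_moveEdge hvs' with ⟨-, hge⟩ | ⟨h, -⟩
    · have hge := hge.resolve_right (fun h => h rfl)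
      subst hge
      rw [moveEdge_self] at hgs
      exact hfe hgs.symm
    · exact hvw h
  · have := h.pos hG hconn hvV
    exact add_pos_of_pos_of_nonneg (pow_pos this r) (Finset.prod_nonneg fun u _ => h.nonneg u)
  · intro s _ _
    exact add_nonneg (pow_nonneg (h.nonneg v) r) (Finset.prod_nonneg fun u _ => h.nonneg u)

end Move

/-! ### Improving a non-hypertree, and the maximizer -/

theorem exists_supertree_spectralRadius_lt {m d k : ℕ} (hk : 3 ≤ k) (hm : 1 ≤ m)
    (hG : G ∈ supertrees α m d k) (hG' : ¬ G.IsHypertree k) :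
    ∃ G' ∈ supertrees α m d k,
      G.signlessLaplacianSpectralRadius k < G'.signlessLaplacianSpectralRadius k := by
  classical
  obtain ⟨r, rfl⟩ : ∃ r, k = r + 1 := ⟨k - 1, by omega⟩
  have hr : r ≠ 0 := by omega
  have hG0 := hG
  obtain ⟨⟨hconn, hac⟩, hunif, hcard, -⟩ := hG0
  have hE : G.edgeSet.Nonempty := Set.nonempty_of_ncard_ne_zero (by omega)
  obtain ⟨e, he, hbranch⟩ : ∃ e ∈ G.edgeSet, 2 < (G.branchVertices e).ncard := by
    by_contra! hno
    obtain ⟨c, hc⟩ := exists_isCore (by omega) hunif hno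
    exact hG' (isHypertree_of_isCore (by omega) ⟨hconn, hac⟩ hunif hE hc)
  obtain ⟨u₁, u₂, u₃, h₁, h₂, h₃, h₁₂, h₁₃, h₂₃⟩ := (Set.two_lt_ncard_iff).1 hbranch
  obtain ⟨C, hC⟩ := hac.exists_separatesEdge he
  have hsub : ∀ {u}, u ∈ G.branchVertices e → u ∈ G.vertexSet := fun h =>
    G.subset_vertexSet_of_mem_edgeSet' he h.1
  obtain ⟨a, ha, b, hb, hab⟩ := G.exists_pathDist_eq_diameter ⟨u₁, hsub h₁⟩
  obtain ⟨q, x, hP⟩ := exists_isPerronPair hunif (by simp) ⟨u₁, hsub h₁⟩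
  -- The labels of `a` and `b` match at most two of the three distinct labels of `u₁`, `u₂`, `u₃`.
  obtain ⟨v, hv, w, hw, hvw, hav, hbv⟩ : ∃ v ∈ G.branchVertices e, ∃ w ∈ G.branchVertices e,
      v ≠ w ∧ C a ≠ C v ∧ C b ≠ C v := by
    have n₁₂ : C u₁ ≠ C u₂ := fun h => h₁₂ (hC.2 h₁.1 h₂.1 h)
    have n₁₃ : C u₁ ≠ C u₃ := fun h => h₁₃ (hC.2 h₁.1 h₃.1 h)
    have n₂₃ : C u₂ ≠ C u₃ := fun h => h₂₃ (hC.2 h₂.1 h₃.1 h)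
    by_cases g₁ : C a ≠ C u₁ ∧ C b ≠ C u₁
    · exact ⟨u₁, h₁, u₂, h₂, h₁₂, g₁⟩
    by_cases g₂ : C a ≠ C u₂ ∧ C b ≠ C u₂
    · exact ⟨u₂, h₂, u₁, h₁, h₁₂.symm, g₂⟩
    · exact ⟨u₃, h₃, u₁, h₁, h₁₃.symm, by grind⟩
  have hfar : (C a = C v → a = v) ∧ (C b = C v → b = v) :=
    ⟨fun h => absurd h hav, fun h => absurd h hbv⟩
  -- The Perron entries dictate the direction of the move; the diameter survives either way because
  -- the diametral ends avoid the branch at `v`.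
  rcases le_total (x v) (x w) with hx | hx
  · exact ⟨_, moveEdges_mem_supertrees hk hG hC he hv.1 hw.1 hvw (hsub hw) ha hb hab (Or.inl hfar),
      spectralRadius_lt_moveEdges hr hunif hconn hC he hv.1 hw.1 hvw (hsub hw) hv hP hx⟩
  · exact ⟨_, moveEdges_mem_supertrees hk hG hC he hw.1 hv.1 hvw.symm (hsub hv) ha hb hab
      (Or.inr hfar),
      spectralRadius_lt_moveEdges hr hunif hconn hC he hw.1 hv.1 hvw.symm (hsub hv) hw hP hx⟩

end Hypergraph

theorem theorem3p2 {α : Type*} [Finite α] (m d k : ℕ) (hk : 3 ≤ k) (hd : 3 ≤ d)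
    (hm : d + 1 ≤ m) (G : Hypergraph α)
    (hG : G ∈ Hypergraph.supertrees α m d k \ Hypergraph.hypertrees α m d k) :
    ∃ G' ∈ Hypergraph.hypertrees α m d k,
      IsGreatest (G.signlessLaplacianModuli k) (G.signlessLaplacianSpectralRadius k) ∧
      IsGreatest (G'.signlessLaplacianModuli k) (G'.signlessLaplacianSpectralRadius k) ∧
      G.signlessLaplacianSpectralRadius k < G'.signlessLaplacianSpectralRadius k := by
  have := Fintype.ofFinite α
  obtain ⟨hS, hH⟩ := hG
  have hgreatest : ∀ H ∈ Hypergraph.supertrees α m d k,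
      IsGreatest (H.signlessLaplacianModuli k) (H.signlessLaplacianSpectralRadius k) := by
    intro H hH
    have hne := Hypergraph.nonempty_vertexSet_of_mem_supertrees (by omega) (by omega) hH
    obtain ⟨r, rfl⟩ : ∃ r, k = r + 1 := ⟨k - 1, by omega⟩
    exact Hypergraph.isGreatest_spectralRadius (by omega) hH.2.1 hne
  have hfin : Finite (Hypergraph α) := by
    refine Finite.of_injective
      (fun H : Hypergraph α => (H.vertexSet, H.edgeSet)) fun H H' h => ?_
    exact Hypergraph.ext (congrArg Prod.fst h) (congrArg Prod.snd h)
  obtain ⟨G', hG', hmax⟩ := Set.exists_max_image (Hypergraph.supertrees α m d k)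
    (fun H => H.signlessLaplacianSpectralRadius k) (Set.toFinite _) ⟨G, hS⟩
  have hyper : G'.IsHypertree k := by
    by_contra hno
    obtain ⟨G'', h1, h2⟩ :=
      Hypergraph.exists_supertree_spectralRadius_lt hk (by omega) hG' hno
    exact absurd h2 (not_lt.2 (hmax G'' h1))
  refine ⟨G', ⟨hyper, hG'.2.2⟩, hgreatest G hS, hgreatest G' hG', ?_⟩
  -- Maximality alone gives only a weak inequality; improving `G` once makes it strict.
  obtain ⟨G'', h1, h2⟩ := Hypergraph.exists_supertree_spectralRadius_lt hk (by omega) hS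
    fun h => hH ⟨h, hS.2.2⟩
  exact h2.trans_le (hmax G'' h1)
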